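/- **Proposition (Endo–Pajitnov manifolds do not admit balanced metrics).** Let $n>1$ and let $M\in \mathrm{SL}(2n+1,\mathbb{Z})$ be a matrix whose eigenvalues are one simple real eigenvalue $\alpha>0$, $\alpha\neq 1$, and non-real eigenvalues $\beta_1,\dots,\beta_k,\overline{\beta_1},\dots,\overline{\beta_k}$ with $\operatorname{Im}\beta_j>0$. Let $W\subset\mathbb{C}^{2n+1}$ be the sum of the generalized eigenspaces $W(\beta_j)=\{x : (M-\beta_j I)^Nx=0 \text{ for some } N\in\mathbb{N}\}$, $1\le j\le k$. Let $a=(a^1,\dots,a^{2n+1})^T\in\mathbb{R}^{2n+1}$ be a non-zero eigenvector of $M$ for $\alpha$, let $b_1,\dots,b_n$ be a basis of $W$, with $b_j=(b_j^1,\dots,b_j^{2n+1})^T$, and put $u_i=(a^i,b_1^i,\dots,b_n^i)\in\mathbb{R}\times\mathbb{C}^n$ for $1\le i\le 2n+1$. Let $R$ be the matrix, in the basis $b_1,\dots,b_n$, of the linear map $W\to W$, $x\mapsto Mx$. Let $\mathbb{H}$ be the upper half-plane and let $G_M$ be the group of automorphisms of $\mathbb{H}\times\mathbb{C}^n$ generated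 by $$g_0(w,z)=(\alpha w,R^Tz),\qquad g_i(w,z)=(w,z)+u_i\quad(1\le i\le 2n+1).$$ The action of $G_M$ on $\mathbb{H}\times\mathbb{C}^n$ is free and properly discontinuous; let $T_M=G_M\backslash(\mathbb{H}\times\mathbb{C}^n)$ be the quotient complex manifold, of complex dimension $n+1$. Then $T_M$ carries no balanced metric: there is no smooth Hermitian metric $g$ on $T_M$ whose fundamental form $\omega(X,Y)=g(JX,Y)$ satisfies $d(\omega^{n})=0$. -/

import Mathlib

open scoped Manifold ContDiff Topology

noncomputable section

namespace EndoPajitnov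

section Linear

variable {V : Type*} [NormedAddCommGroup V] [NormedSpace ℝ V]

/-- The continuous multilinear map `v ↦ ∏ i < k, B (v_{2i}) (v_{2i+1})` in `2k` vectors. -/
def pairProd (B : V →L[ℝ] V →L[ℝ] ℝ) (k : ℕ) :
    ContinuousMultilinearMap ℝ (fun _ : Fin (k * 2) => V) ℝ where
  toFun v := ∏ i : Fin k, B (v (finProdFinEquiv (i, 0))) (v (finProdFinEquiv (i, 1)))
  map_update_add' := by
    intro _ v j x y
    obtain ⟨⟨i, c⟩, rfl⟩ := finProdFinEquiv.surjective j
    have h : ∀ z, ∀ l ∈ Finset.univ.erase i,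
        B (Function.update v (finProdFinEquiv (i, c)) z (finProdFinEquiv (l, 0)))
          (Function.update v (finProdFinEquiv (i, c)) z (finProdFinEquiv (l, 1))) =
        B (v (finProdFinEquiv (l, 0))) (v (finProdFinEquiv (l, 1))) := by
      intro z l hl
      have hl := Finset.ne_of_mem_erase hl
      rw [Function.update_of_ne, Function.update_of_ne] <;> simp [hl]
    simp only [← Finset.mul_prod_erase Finset.univ _ (Finset.mem_univ i),
      Finset.prod_congr rfl (h _), ← add_mul]
    congr 1
    fin_cases c <;> simp [Function.update_of_ne]
  map_update_smul' := by
    intro _ v j r x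
    obtain ⟨⟨i, c⟩, rfl⟩ := finProdFinEquiv.surjective j
    have h : ∀ z, ∀ l ∈ Finset.univ.erase i,
        B (Function.update v (finProdFinEquiv (i, c)) z (finProdFinEquiv (l, 0)))
          (Function.update v (finProdFinEquiv (i, c)) z (finProdFinEquiv (l, 1))) =
        B (v (finProdFinEquiv (l, 0))) (v (finProdFinEquiv (l, 1))) := by
      intro z l hl
      have hl := Finset.ne_of_mem_erase hl
      rw [Function.update_of_ne, Function.update_of_ne] <;> simp [hl]
    simp only [← Finset.mul_prod_erase Finset.univ _ (Finset.mem_univ i),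
      Finset.prod_congr rfl (h _), smul_eq_mul, ← mul_assoc]
    congr 1
    fin_cases c <;> simp [Function.update_of_ne]
  cont := by fun_prop

/-- The `k`-fold wedge power `B ∧ ⋯ ∧ B` of an alternating bilinear form `B`:
`B^k (v_0, …, v_{2k-1}) = 2^{-k} ∑_σ sign σ ∏_{i < k} B (v_{σ(2i)}, v_{σ(2i+1)})`. -/
def wedgePow (B : V →L[ℝ] V →L[ℝ] ℝ) (k : ℕ) : V [⋀^Fin (k * 2)]→L[ℝ] ℝ :=
  ((2 : ℝ) ^ k)⁻¹ • ContinuousMultilinearMap.alternatization (pairProd B k)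

end Linear

section Manifold

variable {E : Type*} [NormedAddCommGroup E] [NormedSpace ℝ E]
  {X : Type*} [TopologicalSpace X] [ChartedSpace E X]

/-- The exterior derivative of a differential `k`-form `η` on a manifold without boundary. At `x` it
is computed in the preferred chart at `x`, the one through which `T_x X` is identified with `E`. -/
def mextDeriv {k : ℕ} (η : ∀ x : X, TangentSpace 𝓘(ℝ, E) x [⋀^Fin k]→L[ℝ] ℝ) (x : X) :
    TangentSpace 𝓘(ℝ, E) x [⋀^Fin (k + 1)]→L[ℝ] ℝ :=
  extDeriv (E := E) (fun y : E => ((η ((chartAt E x).symm y)).compContinuousLinearMap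
    (mfderiv 𝓘(ℝ, E) 𝓘(ℝ, E) (chartAt E x).symm y) : E [⋀^Fin k]→L[ℝ] ℝ)) (chartAt E x x)

variable [NormedSpace ℂ E]

/-- The complex structure `J` on `T_x X`: multiplication by `i` in a holomorphic chart at `x`. -/
def complexStructure (x : X) : TangentSpace 𝓘(ℝ, E) x →L[ℝ] TangentSpace 𝓘(ℝ, E) x :=
  (Complex.I • ContinuousLinearMap.id ℝ E : E →L[ℝ] E)

variable (E X) [IsManifold 𝓘(ℂ, E) ω X] [IsManifold 𝓘(ℝ, E) ∞ X]

/-- A (smooth) Hermitian metric on a complex manifold: a Riemannian metric `g` with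
`g(Jv, Jw) = g(v, w)`. -/
structure HermitianMetric extends
    Bundle.ContMDiffRiemannianMetric 𝓘(ℝ, E) ∞ E (fun x : X => TangentSpace 𝓘(ℝ, E) x) where
  inner_J (x : X) (v w : TangentSpace 𝓘(ℝ, E) x) :
    inner x (complexStructure x v) (complexStructure x w) = inner x v w

namespace HermitianMetric

variable {E X} (Ω : HermitianMetric E X)

/-- The fundamental form `ω(v, w) = g(Jv, w)`. -/
def fundamentalForm (x : X) : TangentSpace 𝓘(ℝ, E) x →L[ℝ] TangentSpace 𝓘(ℝ, E) x →L[ℝ] ℝ :=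
  (Ω.inner x).comp (complexStructure x)

/-- The `2k`-form `ω^k`. -/
def fundamentalPow (k : ℕ) (x : X) : TangentSpace 𝓘(ℝ, E) x [⋀^Fin (k * 2)]→L[ℝ] ℝ :=
  wedgePow (V := E) (Ω.fundamentalForm x) k

/-- A Hermitian metric on a complex manifold of complex dimension `m` is balanced if
`d(ω^(m-1)) = 0`. -/
def IsBalanced : Prop :=
  ∀ x : X, mextDeriv (Ω.fundamentalPow (Module.finrank ℂ E - 1)) x = 0

end HermitianMetric

end Manifold

/-! ### The Endo–Pajitnov manifolds -/

/-- The integer matrix `M`, with complex entries. -/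
def complexMatrix {n : ℕ} (M : Matrix.SpecialLinearGroup (Fin (2 * n + 1)) ℤ) :
    Matrix (Fin (2 * n + 1)) (Fin (2 * n + 1)) ℂ :=
  (M : Matrix (Fin (2 * n + 1)) (Fin (2 * n + 1)) ℤ).map (Int.cast : ℤ → ℂ)

/-- The endomorphism `x ↦ M x` of `ℂ^(2n+1)` (column vectors). -/
def complexEnd {n : ℕ} (M : Matrix.SpecialLinearGroup (Fin (2 * n + 1)) ℤ) :
    Module.End ℂ (Fin (2 * n + 1) → ℂ) :=
  Matrix.toLin' (complexMatrix M)

/-- The space `W`: the sum of the generalized eigenspaces `{x | ∃ N, (M - β)^N x = 0}` over all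
`β` with `Im β > 0` (the summands for which `β` is not an eigenvalue are zero). -/
def upperSpace {n : ℕ} (M : Matrix.SpecialLinearGroup (Fin (2 * n + 1)) ℤ) :
    Submodule ℂ (Fin (2 * n + 1) → ℂ) :=
  ⨆ β : {β : ℂ // 0 < β.im}, (complexEnd M).maxGenEigenspace β.1

theorem mapsTo_upperSpace {n : ℕ} (M : Matrix.SpecialLinearGroup (Fin (2 * n + 1)) ℤ) :
    ∀ x ∈ upperSpace M, complexEnd M x ∈ upperSpace M := by
  intro x hx
  induction hx using Submodule.iSup_induction' with
  | mem i x hx =>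
    exact Submodule.mem_iSup_of_mem i
      (Module.End.mapsTo_maxGenEigenspace_of_comm (Commute.refl (complexEnd M)) i.1 hx)
  | zero => simp
  | add x y _ _ h1 h2 => rw [map_add]; exact add_mem h1 h2

/-- The ambient space `ℂ × ℂⁿ`, with coordinates `(w, z)`. -/
abbrev Model (n : ℕ) : Type := ℂ × (Fin n → ℂ)

/-- `ℍ × ℂⁿ`, as an open subset of `ℂ × ℂⁿ`. -/
def HalfSpace (n : ℕ) : TopologicalSpace.Opens (Model n) where
  carrier := {p | 0 < p.1.im}
  is_open' := isOpen_lt continuous_const (Complex.continuous_im.comp continuous_fst)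

/-- The input of the construction: a matrix `M ∈ SL(2n+1, ℤ)` whose eigenvalues are a simple real
eigenvalue `α > 0`, `α ≠ 1`, and non-real numbers (which then come in conjugate pairs), a real
eigenvector `a` for `α`, and a basis `b` of `W`. -/
structure Datum (n : ℕ) where
  M : Matrix.SpecialLinearGroup (Fin (2 * n + 1)) ℤ
  α : ℝ
  α_pos : 0 < α
  α_ne_one : α ≠ 1
  simple_eigenvalue : (complexMatrix M).charpoly.rootMultiplicity (α : ℂ) = 1
  nonreal : ∀ μ : ℂ, (complexMatrix M).charpoly.IsRoot μ → μ ≠ (α : ℂ) → μ.im ≠ 0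
  a : Fin (2 * n + 1) → ℝ
  a_ne_zero : a ≠ 0
  eigenvector :
    ((M : Matrix (Fin (2 * n + 1)) (Fin (2 * n + 1)) ℤ).map (Int.cast : ℤ → ℝ)).mulVec a = α • a
  b : Module.Basis (Fin n) ℂ (upperSpace M)

namespace Datum

variable {n : ℕ} (D : Datum n)

/-- The vectors `u_i = (a^i, b_1^i, …, b_n^i)`. -/
def u (i : Fin (2 * n + 1)) : Model n :=
  ((D.a i : ℂ), fun j => (D.b j : Fin (2 * n + 1) → ℂ) i)

/-- The matrix `R` of `f_M : W → W`, `x ↦ M x`, in the basis `b`. -/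
def R : Matrix (Fin n) (Fin n) ℂ :=
  LinearMap.toMatrix D.b D.b ((complexEnd D.M).restrict (mapsTo_upperSpace D.M))

theorem complexEnd_injective {n : ℕ} (M : Matrix.SpecialLinearGroup (Fin (2 * n + 1)) ℤ) :
    Function.Injective (complexEnd M) := by
  have h : IsUnit (complexMatrix M) := by
    rw [Matrix.isUnit_iff_isUnit_det]
    have : (complexMatrix M).det = 1 := by
      have := (Int.castRingHom ℂ).map_det (M : Matrix (Fin (2 * n + 1)) (Fin (2 * n + 1)) ℤ)
      rw [M.det_coe] at this
      simpa [complexMatrix] using this.symm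
    rw [this]; exact isUnit_one
  exact Matrix.mulVec_injective_iff_isUnit.2 h

theorem isUnit_det_R : IsUnit D.R.transpose.det := by
  rw [Matrix.det_transpose, R, LinearMap.det_toMatrix, ← LinearMap.isUnit_iff_isUnit_det]
  rw [LinearMap.isUnit_iff_ker_eq_bot, LinearMap.ker_eq_bot]
  · intro x y h
    exact Subtype.ext (complexEnd_injective D.M (congrArg Subtype.val h))

/-- `g_0 (w, z) = (α w, Rᵀ z)`, as a bijection of `ℍ × ℂⁿ`. -/
def g₀ : Equiv.Perm (HalfSpace n) where
  toFun p := ⟨(D.α * p.1.1, D.R.transpose.mulVec p.1.2), by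
    simpa [HalfSpace] using mul_pos D.α_pos p.2⟩
  invFun p := ⟨(((D.α⁻¹ : ℝ) : ℂ) * p.1.1, (D.R.transpose)⁻¹.mulVec p.1.2), by
    have : 0 < D.α⁻¹ * p.1.1.im := mul_pos (inv_pos.2 D.α_pos) p.2
    show 0 < (((D.α⁻¹ : ℝ) : ℂ) * p.1.1).im
    rwa [Complex.im_ofReal_mul]⟩
  left_inv p := by
    have := D.α_pos.ne'
    ext1
    refine Prod.ext ?_ ?_
    · simp [this]
    · simp [Matrix.mulVec_mulVec, Matrix.nonsing_inv_mul _ D.isUnit_det_R]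
  right_inv p := by
    have := D.α_pos.ne'
    ext1
    refine Prod.ext ?_ ?_
    · simp [this]
    · simp [Matrix.mulVec_mulVec, Matrix.mul_nonsing_inv _ D.isUnit_det_R]

/-- `g_i (w, z) = (w, z) + u_i`, as a bijection of `ℍ × ℂⁿ`. -/
def g (i : Fin (2 * n + 1)) : Equiv.Perm (HalfSpace n) where
  toFun p := ⟨p.1 + D.u i, by simpa [HalfSpace, u] using p.2⟩
  invFun p := ⟨p.1 - D.u i, by simpa [HalfSpace, u] using p.2⟩
  left_inv p := by simp
  right_inv p := by simp

/-- The group `G_M` of automorphisms of `ℍ × ℂⁿ` generated by `g_0, g_1, …, g_{2n+1}`. -/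
def G : Subgroup (Equiv.Perm (HalfSpace n)) :=
  Subgroup.closure (insert D.g₀ (Set.range D.g))

/-! ### The action of `G_M` is free and properly discontinuous by biholomorphisms -/

/-- The linear map `(w, z) ↦ (α w, Rᵀ z)`. -/
def A : Model n ≃L[ℂ] Model n :=
  LinearEquiv.toContinuousLinearEquiv
    { toFun := fun p => (D.α * p.1, D.R.transpose.mulVec p.2)
      invFun := fun p => (((D.α⁻¹ : ℝ) : ℂ) * p.1, (D.R.transpose)⁻¹.mulVec p.2)
      map_add' := fun p q => by simp [mul_add, Matrix.mulVec_add]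
      map_smul' := fun c p => by
        refine Prod.ext ?_ ?_
        · simp; ring
        · simp [Matrix.mulVec_smul]
      left_inv := fun p => by
        have := D.α_pos.ne'
        refine Prod.ext ?_ ?_
        · simp [this]
        · simp [Matrix.mulVec_mulVec, Matrix.nonsing_inv_mul _ D.isUnit_det_R]
      right_inv := fun p => by
        have := D.α_pos.ne'
        refine Prod.ext ?_ ?_
        · simp [this]
        · simp [Matrix.mulVec_mulVec, Matrix.mul_nonsing_inv _ D.isUnit_det_R] }

theorem A_apply (p : Model n) : D.A p = ((D.α : ℂ) * p.1, D.R.transpose.mulVec p.2) := rfl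

theorem A_zpow_fst (k : ℤ) (p : Model n) : ((D.A ^ k) p).1 = ((D.α ^ k : ℝ) : ℂ) * p.1 := by
  have h0 : (D.α : ℂ) ≠ 0 := by exact_mod_cast D.α_pos.ne'
  induction k generalizing p with
  | zero =>
    rw [zpow_zero, zpow_zero]
    show p.1 = _
    simp
  | succ k ih =>
    rw [zpow_add_one, zpow_add_one₀ D.α_pos.ne']
    show ((D.A ^ (k : ℤ)) (D.A p)).1 = _
    rw [ih, A_apply]
    push_cast; ring
  | pred k ih =>
    rw [zpow_sub_one, zpow_sub_one₀ D.α_pos.ne']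
    show ((D.A ^ (-(k : ℤ))) (D.A⁻¹ p)).1 = _
    rw [ih]
    show _ * (((D.α⁻¹ : ℝ) : ℂ) * p.1) = _
    push_cast; ring

/-- The integral combination `∑ v_i u_i`. -/
def lat (v : Fin (2 * n + 1) → ℤ) : Model n := ∑ i, v i • D.u i

theorem A_u (i : Fin (2 * n + 1)) : D.A (D.u i) = ∑ j, D.M i j • D.u j := by
  rw [A_apply]
  refine Prod.ext ?_ ?_
  · have := congrFun D.eigenvector i
    simp only [Matrix.mulVec, dotProduct, Matrix.map_apply, Pi.smul_apply, smul_eq_mul] at this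
    simp only [u, Prod.fst_sum, zsmul_eq_mul]
    rw [← Complex.ofReal_mul, ← this]
    push_cast
    rfl
  · funext l
    have h : (complexEnd D.M) (D.b l) = ∑ k, D.R k l • (D.b k : Fin (2 * n + 1) → ℂ) := by
      have h1 := D.b.sum_repr (((complexEnd D.M).restrict (mapsTo_upperSpace D.M)) (D.b l))
      have h2 := congrArg Subtype.val h1
      rw [LinearMap.coe_restrict_apply] at h2
      rw [← h2, AddSubmonoidClass.coe_finsetSum]
      simp [R, LinearMap.toMatrix_apply]
    have h3 := congrFun h i
    simp only [complexEnd, Matrix.toLin'_apply, Matrix.mulVec, dotProduct, complexMatrix,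
      Matrix.map_apply, Finset.sum_apply, Pi.smul_apply, smul_eq_mul] at h3
    simp only [u, Prod.snd_sum, Finset.sum_apply, zsmul_eq_mul,
      Matrix.mulVec, dotProduct, Matrix.transpose_apply]
    rw [← h3]
    simp

theorem A_lat (v : Fin (2 * n + 1) → ℤ) :
    D.A (D.lat v) = D.lat (Matrix.vecMul v (D.M : Matrix _ _ ℤ)) := by
  simp only [lat, map_sum, map_zsmul, A_u, Finset.smul_sum, Matrix.vecMul, dotProduct,
    Finset.sum_smul, smul_smul]
  exact Finset.sum_comm

theorem lat_add (v w : Fin (2 * n + 1) → ℤ) : D.lat (v + w) = D.lat v + D.lat w := by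
  simp [lat, add_smul, Finset.sum_add_distrib]

theorem lat_neg (v : Fin (2 * n + 1) → ℤ) : D.lat (-v) = -D.lat v := by
  simp [lat]

theorem exists_A_zpow_lat (k : ℤ) (v : Fin (2 * n + 1) → ℤ) :
    ∃ v', (D.A ^ k) (D.lat v) = D.lat v' := by
  induction k generalizing v with
  | zero => exact ⟨v, rfl⟩
  | succ k ih =>
    obtain ⟨v', h⟩ := ih (Matrix.vecMul v (D.M : Matrix _ _ ℤ))
    refine ⟨v', ?_⟩
    rw [zpow_add_one, ← h, ← A_lat]
    rfl
  | pred k ih =>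
    obtain ⟨v', h⟩ := ih (Matrix.vecMul v ((D.M⁻¹ : Matrix.SpecialLinearGroup _ ℤ) : Matrix _ _ ℤ))
    refine ⟨v', ?_⟩
    have h1 : D.A (D.lat (Matrix.vecMul v
        ((D.M⁻¹ : Matrix.SpecialLinearGroup _ ℤ) : Matrix _ _ ℤ))) = D.lat v := by
      rw [A_lat, Matrix.vecMul_vecMul, ← Matrix.SpecialLinearGroup.coe_mul, inv_mul_cancel,
        Matrix.SpecialLinearGroup.coe_one, Matrix.vecMul_one]
    rw [zpow_sub_one, ← h, ← h1]
    show (D.A ^ (-(k : ℤ))) (D.A.symm (D.A _)) = _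
    rw [ContinuousLinearEquiv.symm_apply_apply]

/-- Every element of `G_M` has the form `p ↦ A^k p + ∑ v_i u_i`. -/
theorem normal_form (γ : D.G) :
    ∃ (k : ℤ) (v : Fin (2 * n + 1) → ℤ), ∀ p : HalfSpace n,
      (γ • p : HalfSpace n).1 = (D.A ^ k) p.1 + D.lat v := by
  obtain ⟨γ, hγ⟩ := γ
  show ∃ (k : ℤ) (v : Fin (2 * n + 1) → ℤ), ∀ p : HalfSpace n,
      (γ p).1 = (D.A ^ k) p.1 + D.lat v
  induction hγ using Subgroup.closure_induction with
  | mem x hx =>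
    rcases hx with rfl | ⟨i, rfl⟩
    · refine ⟨1, 0, fun p => ?_⟩
      rw [zpow_one]
      simp [lat, A_apply, g₀]
    · refine ⟨0, Pi.single i 1, fun p => ?_⟩
      have : D.lat (Pi.single i 1) = D.u i := by
        rw [lat, Finset.sum_eq_single i]
        · simp
        · intro j _ hj; simp [hj]
        · simp
      rw [this]
      rfl
  | one => exact ⟨0, 0, fun p => by simp [lat]; rfl⟩
  | mul x y _ _ hx hy =>
    obtain ⟨k, v, hx⟩ := hx
    obtain ⟨l, w, hy⟩ := hy
    obtain ⟨w', hw⟩ := D.exists_A_zpow_lat k w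
    refine ⟨k + l, w' + v, fun p => ?_⟩
    rw [Equiv.Perm.mul_apply, hx, hy, map_add, hw, zpow_add, lat_add, add_assoc]
    rfl
  | inv x _ hx =>
    obtain ⟨k, v, hx⟩ := hx
    obtain ⟨w, hw⟩ := D.exists_A_zpow_lat (-k) v
    refine ⟨-k, -w, fun p => ?_⟩
    have h := hx (x⁻¹ p)
    have hxx : x (x⁻¹ p) = p := x.apply_symm_apply p
    rw [hxx] at h
    have h2 : (D.A ^ (-k)) ((D.A ^ k) (x⁻¹ p).1) = (x⁻¹ p).1 := by
      show ((D.A ^ (-k)) * (D.A ^ k)) (x⁻¹ p).1 = _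
      rw [← zpow_add, neg_add_cancel]
      rfl
    rw [h, map_add, h2, hw, lat_neg, add_neg_cancel_right]

/-- The vectors `u_i` are linearly independent over `ℝ`. -/
theorem eq_zero_of_sum_u (c : Fin (2 * n + 1) → ℝ) (hc : ∑ i, c i • D.u i = 0) : c = 0 := by
  set f := complexEnd D.M with hf
  let L : (Fin (2 * n + 1) → ℂ) →ₗ[ℂ] ℂ := ∑ i, (c i : ℂ) • LinearMap.proj i
  have hL : ∀ x, L x = ∑ i, (c i : ℂ) * x i := fun x => by simp [L]
  have ha : L (fun i => (D.a i : ℂ)) = 0 := by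
    have := congrArg Prod.fst hc
    simpa [hL, u, Prod.fst_sum] using this
  have hb : ∀ j, L (D.b j) = 0 := fun j => by
    have := congrFun (congrArg Prod.snd hc) j
    simpa [hL, u, Prod.snd_sum] using this
  have hW : ∀ x ∈ upperSpace D.M, L x = 0 := by
    have : L ∘ₗ (upperSpace D.M).subtype = 0 := D.b.ext fun j => by simpa using hb j
    exact fun x hx => LinearMap.congr_fun this ⟨x, hx⟩
  have hup : ∀ β : ℂ, 0 < β.im → ∀ x ∈ f.maxGenEigenspace β, L x = 0 := fun β hβ x hx =>
    hW x (Submodule.mem_iSup_of_mem (⟨β, hβ⟩ : {β : ℂ // 0 < β.im}) hx)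
  have hfs : ∀ (β : ℂ) (x), star ((f - β • 1) x) = (f - (star β) • 1) (star x) := fun β x => by
    funext i
    simp [hf, complexEnd, complexMatrix, Matrix.mulVec, dotProduct]
  have hfp : ∀ (β : ℂ) (N : ℕ) (x),
      star (((f - β • 1) ^ N) x) = ((f - (star β) • 1) ^ N) (star x) := fun β N => by
    induction N with
    | zero => simp
    | succ N ih => intro x; rw [pow_succ, pow_succ, Module.End.mul_apply, ih, hfs]; rfl
  have hdown : ∀ β : ℂ, β.im < 0 → ∀ x ∈ f.maxGenEigenspace β, L x = 0 := fun β hβ x hx => by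
    obtain ⟨N, hN⟩ := (Module.End.mem_maxGenEigenspace _ _ _).1 hx
    have h1 := hup (star β) (by simpa using hβ) (star x)
      ((Module.End.mem_maxGenEigenspace _ _ _).2 ⟨N, by rw [← hfp, hN, star_zero]⟩)
    have h2 : L (star x) = star (L x) := by simp [hL]
    rw [h2] at h1
    exact star_eq_zero.1 h1
  have hchar : f.charpoly = (complexMatrix D.M).charpoly := by
    rw [hf, complexEnd]; exact Matrix.charpoly_toLin' _
  have hreal : ∀ β : ℂ, β.im = 0 → ∀ x ∈ f.maxGenEigenspace β, L x = 0 := fun β hβ x hx => by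
    have hfin := LinearMap.finrank_maxGenEigenspace_eq f β
    rw [hchar] at hfin
    by_cases hβα : β = (D.α : ℂ)
    · rw [hβα] at hfin hx
      rw [D.simple_eigenvalue] at hfin
      have hae : (fun i => (D.a i : ℂ)) ∈ f.maxGenEigenspace (D.α : ℂ) := by
        refine Module.End.eigenspace_le_maxGenEigenspace (Module.End.mem_eigenspace_iff.2 ?_)
        funext i
        have := congrFun D.eigenvector i
        simp only [Matrix.mulVec, dotProduct, Matrix.map_apply, Pi.smul_apply, smul_eq_mul] at this
        simp only [hf, complexEnd, complexMatrix, Matrix.toLin'_apply, Matrix.mulVec, dotProduct,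
          Matrix.map_apply, Pi.smul_apply, smul_eq_mul]
        rw [← Complex.ofReal_mul, ← this]
        push_cast
        rfl
      have hane : (⟨_, hae⟩ : f.maxGenEigenspace (D.α : ℂ)) ≠ 0 := by
        intro h
        apply D.a_ne_zero
        funext i
        exact Complex.ofReal_eq_zero.1 (congrFun (congrArg Subtype.val h) i)
      obtain ⟨t, ht⟩ := (finrank_eq_one_iff_of_nonzero' _ hane).1 hfin ⟨x, hx⟩
      have : x = t • (fun i => (D.a i : ℂ)) := (congrArg Subtype.val ht).symm
      rw [this, map_smul, ha, smul_zero]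
    · have h0 : (complexMatrix D.M).charpoly.rootMultiplicity β = 0 :=
        Polynomial.rootMultiplicity_eq_zero fun hr => D.nonreal β hr hβα hβ
      rw [h0, Submodule.finrank_eq_zero] at hfin
      rw [hfin, Submodule.mem_bot] at hx
      rw [hx, map_zero]
  have hall : ∀ x, L x = 0 := fun x => by
    have hx : x ∈ ⨆ β, f.maxGenEigenspace β := by
      rw [Module.End.iSup_maxGenEigenspace_eq_top]; trivial
    induction hx using Submodule.iSup_induction' with
    | mem β x hx =>
      rcases lt_trichotomy β.im 0 with h | h | h
      · exact hdown β h x hx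
      · exact hreal β h x hx
      · exact hup β h x hx
    | zero => exact map_zero L
    | add x y _ _ hx hy => rw [map_add, hx, hy, add_zero]
  funext i
  have := hall (Pi.single i 1)
  rw [hL, Finset.sum_eq_single i] at this
  · simpa using this
  · intro j _ hj; simp [hj]
  · simp

theorem lat_injective : Function.Injective D.lat := by
  intro v w h
  have := D.eq_zero_of_sum_u (fun i => ((v i - w i : ℤ) : ℝ)) (by
    have h2 : D.lat (v - w) = 0 := by rw [sub_eq_add_neg, lat_add, lat_neg, h, add_neg_cancel]
    rw [← h2, lat]
    refine Finset.sum_congr rfl fun i _ => ?_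
    rw [Int.cast_smul_eq_zsmul]; rfl)
  funext i
  have := congrFun this i
  simp only [Pi.zero_apply, Int.cast_eq_zero] at this
  omega

theorem finite_lat_of_isBounded {B : Set (Model n)} (hB : Bornology.IsBounded B) :
    {v | D.lat v ∈ B}.Finite := by
  let F : (Fin (2 * n + 1) → ℝ) →ₗ[ℝ] Model n := Fintype.linearCombination ℝ D.u
  have hF : LinearMap.ker F = ⊥ := by
    rw [LinearMap.ker_eq_bot']
    intro c hc
    exact D.eq_zero_of_sum_u c (by simpa [F, Fintype.linearCombination_apply] using hc)
  obtain ⟨K, -, hK⟩ := F.exists_antilipschitzWith hF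
  have h1 : Bornology.IsBounded (F ⁻¹' B) := hK.isBounded_preimage hB
  let ι : (Fin (2 * n + 1) → ℤ) → (Fin (2 * n + 1) → ℝ) := fun v i => (v i : ℝ)
  have hι : Isometry ι := Isometry.of_dist_eq fun v w => by
    simp only [dist_pi_def, ι]
    congr 2
  have h2 : Bornology.IsBounded (ι ⁻¹' (F ⁻¹' B)) := hι.antilipschitz.isBounded_preimage h1
  refine (h2.isCompact_closure.finite_of_discrete).subset fun v hv => subset_closure ?_
  show F (ι v) ∈ B
  have : F (ι v) = D.lat v := by
    simp only [F, Fintype.linearCombination_apply, lat, ι]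
    exact Finset.sum_congr rfl fun i _ => by rw [Int.cast_smul_eq_zsmul]
  rw [this]; exact hv

/-- An element of `G_M` with its exponents. -/
theorem smul_ext {γ δ : D.G} {k : ℤ} {v : Fin (2 * n + 1) → ℤ}
    (hγ : ∀ p : HalfSpace n, (γ • p : HalfSpace n).1 = (D.A ^ k) p.1 + D.lat v)
    (hδ : ∀ p : HalfSpace n, (δ • p : HalfSpace n).1 = (D.A ^ k) p.1 + D.lat v) : γ = δ :=
  Subtype.ext (Equiv.ext fun p => Subtype.ext ((hγ p).trans (hδ p).symm))

theorem im_smul {γ : D.G} {k : ℤ} {v : Fin (2 * n + 1) → ℤ}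
    (hγ : ∀ p : HalfSpace n, (γ • p : HalfSpace n).1 = (D.A ^ k) p.1 + D.lat v)
    (p : HalfSpace n) : (γ • p : HalfSpace n).1.1.im = D.α ^ k * p.1.1.im := by
  have h0 : (D.lat v).1.im = 0 := by
    simp [lat, u, Prod.fst_sum]
  rw [hγ, Prod.fst_add, A_zpow_fst, Complex.add_im, h0, Complex.im_ofReal_mul, add_zero]

instance : ContinuousConstSMul D.G (HalfSpace n) where
  continuous_const_smul γ := by
    obtain ⟨k, v, h⟩ := D.normal_form γ
    refine Continuous.subtype_mk (f := fun p : HalfSpace n => (γ • p : HalfSpace n).1) ?_ _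
    simp only [h]
    exact ((D.A ^ k).continuous.comp continuous_subtype_val).add continuous_const

instance : IsCancelSMul D.G (HalfSpace n) where
  right_cancel' γ δ p h := by
    suffices H : ∀ γ : D.G, γ • p = p → γ = 1 by
      have := H (δ⁻¹ * γ) (by rw [mul_smul, h, inv_smul_smul])
      exact (inv_mul_eq_one.1 this).symm
    intro γ h
    obtain ⟨k, v, hγ⟩ := D.normal_form γ
    have him := D.im_smul hγ p
    rw [h] at him
    have hp : p.1.1.im ≠ 0 := ne_of_gt p.2
    have hk : k = 0 := by
      have : D.α ^ k = 1 := by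
        field_simp at him
        exact him.symm
      exact (zpow_eq_one_iff_right₀ D.α_pos.le D.α_ne_one).1 this
    subst hk
    have hv : D.lat v = 0 := by
      have := hγ p
      rw [h, zpow_zero] at this
      exact left_eq_add.1 this
    refine D.smul_ext hγ fun q => ?_
    rw [one_smul, hv, zpow_zero]
    exact (add_zero _).symm

instance : LocallyCompactSpace (HalfSpace n) :=
  (HalfSpace n).isOpen.locallyCompactSpace

theorem exists_im_bounds {K : Set (HalfSpace n)} (hK : IsCompact K) :
    ∃ c C : ℝ, 0 < c ∧ ∀ p ∈ K, c ≤ p.1.1.im ∧ p.1.1.im ≤ C := by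
  have hcont : Continuous fun p : HalfSpace n => p.1.1.im :=
    Complex.continuous_im.comp (continuous_fst.comp continuous_subtype_val)
  rcases K.eq_empty_or_nonempty with rfl | hne
  · exact ⟨1, 1, one_pos, by simp⟩
  obtain ⟨p, -, hp⟩ := hK.exists_isMinOn hne hcont.continuousOn
  obtain ⟨q, -, hq⟩ := hK.exists_isMaxOn hne hcont.continuousOn
  exact ⟨_, _, p.2, fun r hr => ⟨hp hr, hq hr⟩⟩

theorem finite_zpow_mem_Icc (c C : ℝ) (hc : 0 < c) :
    {k : ℤ | D.α ^ k ∈ Set.Icc c C}.Finite := by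
  have hlog : Real.log D.α ≠ 0 := Real.log_ne_zero_of_pos_of_ne_one D.α_pos D.α_ne_one
  let f : ℤ → ℝ := fun k => k * Real.log D.α
  have h1 : Filter.Tendsto f Filter.cofinite (Filter.cocompact ℝ) :=
    (Homeomorph.mulRight₀ _ hlog).isClosedEmbedding.tendsto_cocompact.comp Int.tendsto_coe_cofinite
  have h2 := h1 (isCompact_Icc (a := Real.log c) (b := Real.log C)).compl_mem_cocompact
  rw [Filter.mem_map, Filter.mem_cofinite] at h2
  refine h2.subset fun k hk => ?_
  simp only [Set.mem_compl_iff, Set.mem_preimage, not_not, f]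
  rw [← Real.log_zpow]
  exact ⟨Real.log_le_log hc hk.1, Real.log_le_log (zpow_pos D.α_pos k) hk.2⟩

section

open scoped Pointwise

instance : ProperlyDiscontinuousSMul D.G (HalfSpace n) where
  finite_disjoint_inter_image {K L} hK hL := by
    choose k v hkv using D.normal_form
    obtain ⟨c, C, hc, hcC⟩ := exists_im_bounds hK
    obtain ⟨c', C', hc', hcC'⟩ := exists_im_bounds hL
    have hinj : Function.Injective fun γ : D.G => (k γ, v γ) := fun γ δ h => by
      simp only [Prod.mk.injEq] at h
      refine D.smul_ext (hkv γ) fun p => ?_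
      rw [h.1, h.2]
      exact hkv δ p
    let S : Set ℤ := {j | D.α ^ j ∈ Set.Icc (c' / C) (C' / c)}
    let V : ℤ → Set (Fin (2 * n + 1) → ℤ) := fun j =>
      {w | D.lat w ∈ (Subtype.val '' L) - ((D.A ^ j) '' (Subtype.val '' K))}
    have hV : ∀ j, (V j).Finite := fun j =>
      D.finite_lat_of_isBounded ((hL.image continuous_subtype_val).isBounded.sub
        ((hK.image continuous_subtype_val).image (D.A ^ j).continuous).isBounded)
    by_cases hCpos : 0 < C
    swap
    · have hKe : K = ∅ := Set.eq_empty_of_forall_notMem fun p hp => by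
        have := hcC p hp
        linarith
      simp [hKe]
    have hS : S.Finite := D.finite_zpow_mem_Icc _ _ (div_pos hc' hCpos)
    refine Set.Finite.of_finite_image (f := fun γ : D.G => (k γ, v γ)) ?_ hinj.injOn
    refine (hS.biUnion fun j _ => (Set.finite_singleton j).prod (hV j)).subset ?_
    rintro _ ⟨γ, ⟨_, ⟨p, hpK, rfl⟩, hpL⟩, rfl⟩
    simp only [Set.mem_iUnion, Set.mem_prod, Set.mem_singleton_iff]
    refine ⟨k γ, ?_, rfl, ?_⟩
    · have h1 := hcC p hpK
      have h2 := hcC' _ hpL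
      have him := D.im_smul (hkv γ) p
      simp only at h2
      rw [him] at h2
      have hα := zpow_pos D.α_pos (k γ)
      have hp : 0 < p.1.1.im := p.2
      constructor
      · rw [div_le_iff₀ hCpos]
        exact h2.1.trans (mul_le_mul_of_nonneg_left h1.2 hα.le)
      · rw [le_div_iff₀ hc]
        exact (mul_le_mul_of_nonneg_left h1.1 hα.le).trans h2.2
    · refine ⟨_, ⟨_, hpL, rfl⟩, _, ⟨_, ⟨p, hpK, rfl⟩, rfl⟩, ?_⟩
      show (γ • p : HalfSpace n).1 - _ = _
      rw [hkv γ p, add_sub_cancel_left]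

end

/-- The Endo–Pajitnov manifold `T_M = G_M \ (ℍ × ℂⁿ)`. Its charts are the local inverses of the
projection from `ℍ × ℂⁿ`, by Mathlib's instance for quotients of manifolds. -/
abbrev T : Type := MulAction.orbitRel.Quotient D.G (HalfSpace n)

/-- The projection `ℍ × ℂⁿ → T_M`. -/
def proj : HalfSpace n → D.T := Quotient.mk _

/-- A chart of `T_M` is a local inverse of the projection. -/
theorem exists_localInverse {e : OpenPartialHomeomorph D.T (Model n)}
    (he : e ∈ atlas (Model n) D.T) :
    ∃ li : OpenPartialHomeomorph D.T (HalfSpace n),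
      (li.symm : HalfSpace n → D.T) = D.proj ∧
      (∀ t ∈ e.source, t ∈ li.source ∧ e t = (li t).1) ∧
      ∀ z ∈ e.target, ∃ hz : z ∈ HalfSpace n, e.symm z = D.proj ⟨z, hz⟩ := by
  have hloc : IsLocalHomeomorph D.proj :=
    (isQuotientCoveringMap_quotientMk_of_properlyDiscontinuousSMul
      (G := D.G) (E := HalfSpace n)).isCoveringMap.isLocalHomeomorph
  have key : ∀ x : HalfSpace n, e = (hloc.localInverseAt x).trans (chartAt (Model n) x) →
      ∃ li : OpenPartialHomeomorph D.T (HalfSpace n),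
      (li.symm : HalfSpace n → D.T) = D.proj ∧
      (∀ t ∈ e.source, t ∈ li.source ∧ e t = (li t).1) ∧
      ∀ z ∈ e.target, ∃ hz : z ∈ HalfSpace n, e.symm z = D.proj ⟨z, hz⟩ := by
    rintro x rfl
    refine ⟨hloc.localInverseAt x, hloc.localInverseAt_symm x, fun t ht => ⟨ht.1, rfl⟩, ?_⟩
    intro z hz
    have h1 : ((chartAt (Model n) x).symm z).1 = z := (chartAt (Model n) x).right_inv hz.1
    refine ⟨h1 ▸ ((chartAt (Model n) x).symm z).2, ?_⟩
    show (hloc.localInverseAt x).symm ((chartAt (Model n) x).symm z) = _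
    rw [hloc.localInverseAt_symm x]
    exact congrArg D.proj (Subtype.ext h1)
  obtain ⟨q, hq⟩ := he
  exact key _ hq.symm

/-- A change of charts of `T_M` is locally given by an element of `G_M`. -/
theorem eventuallyEq_transition {e e' : OpenPartialHomeomorph D.T (Model n)}
    (he : e ∈ atlas (Model n) D.T) (he' : e' ∈ atlas (Model n) D.T) {y : Model n}
    (hy : y ∈ (e.symm ≫ₕ e').source) :
    ∃ (k : ℤ) (v : Fin (2 * n + 1) → ℤ),
      ∀ᶠ z in 𝓝 y, (e.symm ≫ₕ e') z = (D.A ^ k) z + D.lat v := by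
  obtain ⟨-, -, -, htgt⟩ := D.exists_localInverse he
  obtain ⟨li, hsymm, hsrc, -⟩ := D.exists_localInverse he'
  have hmem : ∀ z ∈ (e.symm ≫ₕ e').source, ∃ hz : z ∈ HalfSpace n,
      (e.symm ≫ₕ e') z = (li (D.proj ⟨z, hz⟩)).1 ∧ D.proj ⟨z, hz⟩ ∈ li.source := by
    intro z hz
    obtain ⟨hz1, h1⟩ := htgt z hz.1
    have hz2 : e.symm z ∈ e'.source := hz.2
    obtain ⟨h2, h3⟩ := hsrc _ hz2
    rw [h1] at h2
    refine ⟨hz1, ?_, h2⟩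
    rw [← h1]
    exact h3
  obtain ⟨hyH, -, hyl⟩ := hmem y hy
  have hπ : D.proj (li (D.proj ⟨y, hyH⟩)) = D.proj ⟨y, hyH⟩ := by
    rw [← hsymm]
    have := li.left_inv hyl
    rw [← hsymm] at this
    exact this
  obtain ⟨γ, hγ⟩ : ∃ γ : D.G, γ • (⟨y, hyH⟩ : HalfSpace n) = li (D.proj ⟨y, hyH⟩) :=
    Quotient.exact hπ
  obtain ⟨k, v, hkv⟩ := D.normal_form γ
  refine ⟨k, v, ?_⟩
  have hnear : ∀ᶠ p in 𝓝 (⟨y, hyH⟩ : HalfSpace n), γ • p ∈ li.target := by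
    refine (continuous_const_smul γ).continuousAt.eventually (li.open_target.mem_nhds ?_)
    show γ • (⟨y, hyH⟩ : HalfSpace n) ∈ li.target
    rw [hγ]
    exact li.map_source hyl
  have hnear' : ∀ᶠ z in 𝓝 y, ∀ hz : z ∈ HalfSpace n, γ • (⟨z, hz⟩ : HalfSpace n) ∈ li.target := by
    rw [nhds_subtype_eq_comap] at hnear
    obtain ⟨s, hs, hsub⟩ := Filter.mem_comap.1 hnear
    filter_upwards [hs] with z hz hzH
    exact hsub (a := (⟨z, hzH⟩ : HalfSpace n)) hz
  filter_upwards [hnear', (e.symm ≫ₕ e').open_source.mem_nhds hy] with z hz hzs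
  obtain ⟨hzH, h1, -⟩ := hmem z hzs
  rw [h1, ← hkv ⟨z, hzH⟩]
  have h2 : D.proj ⟨z, hzH⟩ = li.symm (γ • (⟨z, hzH⟩ : HalfSpace n)) := by
    rw [hsymm]
    exact Quotient.sound ⟨γ⁻¹, inv_smul_smul γ _⟩
  rw [h2, li.right_inv (hz hzH)]

instance : IsManifold 𝓘(ℂ, Model n) ω D.T := by
  refine isManifold_of_contDiffOn _ _ _ fun e e' he he' => ?_
  intro y hy
  obtain ⟨k, v, h⟩ := D.eventuallyEq_transition he he' (y := y) (by simpa using hy)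
  refine ContDiffAt.contDiffWithinAt ?_
  exact (((D.A ^ k).contDiff.add contDiff_const).contDiffAt).congr_of_eventuallyEq h

instance : IsManifold 𝓘(ℝ, Model n) ∞ D.T := by
  refine isManifold_of_contDiffOn _ _ _ fun e e' he he' => ?_
  intro y hy
  obtain ⟨k, v, h⟩ := D.eventuallyEq_transition he he' (y := y) (by simpa using hy)
  refine ContDiffAt.contDiffWithinAt ?_
  exact ((((D.A ^ k).contDiff.restrict_scalars ℝ).add contDiff_const).contDiffAt).congr_of_eventuallyEq h

end Datum
end EndoPajitnov

end

open scoped Manifold ContDiff Topology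

noncomputable section

namespace EndoPajitnov

/-! ### Positivity of wedge powers on symplectic frames -/

section WedgePositivity

/-! Suppose `ω` is the fundamental form of a balanced metric, and let `φ` be the pullback of `ω^n`
to `ℍ × ℂⁿ`. It is a closed `2n`-form invariant under `G_M` (`extDeriv_pullbackPow`,
`pullbackPow_affine`). With `x = Re w`, the form `φ ∧ dx` is closed and invariant under the
translations `g_i`, so its integral over the torus `{Im w = y} / ⟨u_1, …, u_{2n+1}⟩` does not depend
on `y`. On the other hand `g_0` maps the torus at height `y` to the one at height `αy` and
multiplies `dx` by `α`, so the integral is also multiplied by `α`. As `α ≠ 1`, it must vanish. But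
on that torus `φ ∧ dx` is a constant volume form times the value of `φ` on a real basis of the
vertical space `ℂⁿ`, and this value has no zeros: `ω^n` restricts to a volume form on every complex
`n`-dimensional subspace (`pullbackPow_ne_zero`). This is a contradiction.

The formal version replaces `φ ∧ dx` by the function `φ(e_1, …, e_{2n})` for a fixed vertical basis
`e`, integrated over the unit cube in the coordinates given by the `u_i`; this is `flux`.
Independence of `y` is the divergence theorem (`flux_eq_of_le`). The behaviour under `g_0` is a
factor `det_ℝ Rᵀ` (`flux_mul`), which equals `α⁻¹` because `det M = 1` (`alpha_mul_det_fibreMap`).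
-/

theorem sign_mul_prod_nonneg {k : ℕ} {β : Fin k × Fin 2 → Fin k × Fin 2 → ℝ}
    (hne : ∀ p q, p.1 ≠ q.1 → β p q = 0)
    (hβ : ∀ i (g : Equiv.Perm (Fin 2)), β (i, g 0) (i, g 1) = (Equiv.Perm.sign g : ℤ))
    (τ : Equiv.Perm (Fin k × Fin 2)) :
    0 ≤ ((Equiv.Perm.sign τ : ℤ) : ℝ) * ∏ i, β (τ (i, 0)) (τ (i, 1)) := by
  by_cases h : ∀ i, (τ (i, 0)).1 = (τ (i, 1)).1
  swap
  -- If some pair is split between two blocks, its factor vanishes; so only permutations carrying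
  -- pairs to pairs matter.
  · push Not at h
    obtain ⟨i, hi⟩ := h
    rw [Finset.prod_eq_zero (Finset.mem_univ i) (hne _ _ hi), mul_zero]
  have h' : ∀ i c, (τ (i, c)).1 = (τ (i, 0)).1 := fun i c => by
    fin_cases c
    · rfl
    · exact (h i).symm
  have hsurj : Function.Surjective fun i => (τ (i, 0)).1 := fun j => by
    refine ⟨(τ.symm (j, 0)).1, ?_⟩
    have := h' (τ.symm (j, 0)).1 (τ.symm (j, 0)).2
    simpa using this.symm
  let π : Equiv.Perm (Fin k) := Equiv.ofBijective _ (Finite.injective_iff_bijective.1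
    (Finite.injective_iff_surjective.2 hsurj))
  have hginj : ∀ i, Function.Injective fun c => (τ (i, c)).2 := fun i c d hcd => by
    have : τ (i, c) = τ (i, d) := Prod.ext ((h' i c).trans (h' i d).symm) hcd
    exact (Prod.mk.inj (τ.injective this)).2
  let g : Fin k → Equiv.Perm (Fin 2) := fun i => Equiv.ofBijective _
    (Finite.injective_iff_bijective.1 (hginj i))
  -- A permutation that respects the pairs flips inside each pair and then moves the pairs by `π`.
  -- The second step acts by `π` on both columns, so its sign is a square and only the flips count.
  have hτ : τ = Equiv.prodCongrLeft (fun _ => π) * Equiv.prodCongrRight g := by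
    ext1 ⟨i, c⟩
    exact Prod.ext (h' i c) rfl
  have hsign : Equiv.Perm.sign τ = ∏ i, Equiv.Perm.sign (g i) := by
    rw [hτ, Equiv.Perm.sign_mul, Equiv.Perm.sign_prodCongrLeft, Equiv.Perm.sign_prodCongrRight]
    simp
  have hprod : ∏ i, β (τ (i, 0)) (τ (i, 1)) = ((Equiv.Perm.sign τ : ℤ) : ℝ) := by
    rw [hsign, Units.coe_prod, Int.cast_prod]
    refine Finset.prod_congr rfl fun i _ => ?_
    rw [← hβ (π i) (g i), hτ]
    rfl
  rw [hprod]
  exact mul_self_nonneg _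

variable {V : Type*} [NormedAddCommGroup V] [NormedSpace ℝ V]

theorem wedgePow_apply (B : V →L[ℝ] V →L[ℝ] ℝ) (k : ℕ) (v : Fin (k * 2) → V) :
    wedgePow B k v = ((2 : ℝ) ^ k)⁻¹ * ∑ σ : Equiv.Perm (Fin (k * 2)),
      ((Equiv.Perm.sign σ : ℤ) : ℝ) * ∏ i : Fin k, B (v (σ (finProdFinEquiv (i, 0))))
        (v (σ (finProdFinEquiv (i, 1)))) := by
  rw [wedgePow, ContinuousAlternatingMap.smul_apply,
    ContinuousMultilinearMap.alternatization_apply_apply, smul_eq_mul]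
  congr 1
  refine Finset.sum_congr rfl fun σ _ => ?_
  rw [Units.smul_def, zsmul_eq_mul]
  rfl

theorem wedgePow_compContinuousLinearMap {V' : Type*} [NormedAddCommGroup V'] [NormedSpace ℝ V']
    (B : V →L[ℝ] V →L[ℝ] ℝ) (k : ℕ) (L : V' →L[ℝ] V) :
    (wedgePow B k).compContinuousLinearMap L = wedgePow (B.bilinearComp L L) k := by
  ext v
  simp [wedgePow_apply]

/-- No cancellation occurs in the sum over permutations: every term is nonnegative by
`sign_mul_prod_nonneg`, and the identity contributes `1`. -/
theorem wedgePow_pos_of_symplectic {B : V →L[ℝ] V →L[ℝ] ℝ} {k : ℕ} {f : Fin k × Fin 2 → V}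
    (hne : ∀ p q, p.1 ≠ q.1 → B (f p) (f q) = 0)
    (h1 : ∀ i, B (f (i, 0)) (f (i, 1)) = 1) (h2 : ∀ i, B (f (i, 1)) (f (i, 0)) = -1) :
    0 < wedgePow B k (f ∘ finProdFinEquiv.symm) := by
  rw [wedgePow_apply]
  refine mul_pos (by positivity) (Finset.sum_pos' (fun σ _ => ?_) ⟨1, Finset.mem_univ _, ?_⟩)
  · have := sign_mul_prod_nonneg (β := fun p q => B (f p) (f q)) hne (fun i g => ?_)
      (finProdFinEquiv.symm.permCongr σ)
    · rw [Equiv.Perm.sign_permCongr] at this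
      simpa [Equiv.permCongr_apply] using this
    · have hg : g = 1 ∨ g = Equiv.swap 0 1 := by
        revert g; decide
      rcases hg with rfl | rfl
      · simp [h1]
      · simp [h2]
  · simp [h1]

end WedgePositivity

/-! ### Hermitian inner products and non-degeneracy of the top power of the fundamental form -/

section Hermitian

variable {V : Type*} [NormedAddCommGroup V] [NormedSpace ℝ V] [Module ℂ V] [IsScalarTower ℝ ℂ V]

/-- The Hermitian inner product with real part `g`. -/
@[reducible] def hermitianCore (g : V →L[ℝ] V →L[ℝ] ℝ) (hsymm : ∀ v w, g v w = g w v)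
    (hpos : ∀ v, v ≠ 0 → 0 < g v v)
    (hJ : ∀ v w, g (Complex.I • v) (Complex.I • w) = g v w) : InnerProductSpace.Core ℂ V where
  inner x y := ⟨g x y, g (Complex.I • x) y⟩
  conj_inner_symm x y := by
    have h : g (Complex.I • y) x = -g (Complex.I • x) y := by
      rw [← hJ (Complex.I • y), smul_smul, Complex.I_mul_I, hsymm]
      simp
    apply Complex.ext
    · exact hsymm y x
    · simp [h]
  re_inner_nonneg x := by
    rcases eq_or_ne x 0 with rfl | hx
    · simp
    · exact (hpos x hx).le
  add_left x y z := by
    apply Complex.ext <;> simp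
  smul_left x y r := by
    have hr : ∀ z : V, r • z = r.re • z + r.im • (Complex.I • z) := fun z => by
      conv_lhs => rw [← Complex.re_add_im r]
      rw [add_smul, mul_smul, ← Complex.coe_algebraMap, algebraMap_smul, algebraMap_smul,
        smul_comm]
    have hI : Complex.I • r • x = r • Complex.I • x := smul_comm _ _ _
    apply Complex.ext
    · simp [hr x]
    · change g (Complex.I • r • x) y = _
      rw [hI, hr (Complex.I • x), smul_smul Complex.I, Complex.I_mul_I]
      simp
  definite x hx := by
    by_contra h
    exact (hpos x h).ne' (congrArg Complex.re hx)

theorem exists_unitary_basis [FiniteDimensional ℂ V] (g : V →L[ℝ] V →L[ℝ] ℝ)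
    (hsymm : ∀ v w, g v w = g w v) (hpos : ∀ v, v ≠ 0 → 0 < g v v)
    (hJ : ∀ v w, g (Complex.I • v) (Complex.I • w) = g v w) :
    ∃ f : Fin (Module.finrank ℂ V) → V, (∀ i, g (f i) (f i) = 1) ∧
      ∀ i j, i ≠ j → g (f i) (f j) = 0 ∧ g (Complex.I • f i) (f j) = 0 := by
  let c := hermitianCore g hsymm hpos hJ
  suffices H : ∃ f : Fin (Module.finrank ℂ V) → V, ∀ i j, c.inner (f i) (f j) =
      if i = j then 1 else 0 by
    obtain ⟨f, hf⟩ := H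
    refine ⟨f, fun i => ?_, fun i j hij => ⟨?_, ?_⟩⟩
    · have := congrArg Complex.re (hf i i)
      rw [if_pos rfl] at this
      exact this
    · have := congrArg Complex.re (hf i j)
      rw [if_neg hij] at this
      exact this
    · have := congrArg Complex.im (hf i j)
      rw [if_neg hij] at this
      exact this
  -- The norm of the Hermitian product replaces the given one only here, where the goal no longer
  -- involves the continuity of `g`.
  let _ : NormedAddCommGroup V := @InnerProductSpace.Core.toNormedAddCommGroup ℂ V _ _ _ c
  let _ : InnerProductSpace ℂ V := InnerProductSpace.ofCore c.toCore
  exact ⟨stdOrthonormalBasis ℂ V, orthonormal_iff_ite.1 (stdOrthonormalBasis ℂ V).orthonormal⟩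

/-- For a unitary basis `f`, the vectors `f i, I • f i` form a symplectic frame, on which the power
is positive. A top-degree alternating form vanishing on one basis is zero, so it cannot vanish on
`e`. -/
theorem wedgePow_ne_zero [FiniteDimensional ℂ V] {k : ℕ} (hk : Module.finrank ℂ V = k)
    {g B : V →L[ℝ] V →L[ℝ] ℝ} (hsymm : ∀ v w, g v w = g w v) (hpos : ∀ v, v ≠ 0 → 0 < g v v)
    (hJ : ∀ v w, g (Complex.I • v) (Complex.I • w) = g v w)
    (hB : ∀ v w, B v w = g (Complex.I • v) w) (e : Module.Basis (Fin (k * 2)) ℝ V) :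
    wedgePow B k e ≠ 0 := by
  obtain ⟨f, h1, h2⟩ := exists_unitary_basis g hsymm hpos hJ
  subst hk
  have hII : ∀ v w, g (Complex.I • Complex.I • v) w = -g v w := fun v w => by
    rw [smul_smul, Complex.I_mul_I]
    simp
  let F : Fin (Module.finrank ℂ V) × Fin 2 → V := fun p => if p.2 = 0 then f p.1 else Complex.I • f p.1
  have hF := wedgePow_pos_of_symplectic (B := B) (f := F) ?_ ?_ ?_
  · intro h0
    have := (AlternatingMap.map_basis_eq_zero_iff e (wedgePow B _).toAlternatingMap).1 h0
    have h3 := congrArg (fun φ => φ (F ∘ finProdFinEquiv.symm)) this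
    exact hF.ne' h3
  · rintro ⟨i, c⟩ ⟨j, d⟩ hij
    fin_cases c <;> fin_cases d <;> simp [F, hB, hJ, hII, h2 i j hij]
  · intro i
    simp [F, hB, hJ, h1]
  · intro i
    simp [F, hB, hII, h1]

end Hermitian

/-! ### Integrals over the unit cube: sign, `SL(m, ℤ)`-invariance, divergence theorem -/

section BoxIntegrals

open MeasureTheory

theorem setIntegral_Icc_pos {m : ℕ} {c : (Fin m → ℝ) → ℝ} (hc : ContinuousOn c (Set.Icc 0 1))
    (h0 : ∀ t ∈ Set.Icc (0 : Fin m → ℝ) 1, 0 < c t) : 0 < ∫ t in Set.Icc 0 1, c t := by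
  rw [setIntegral_pos_iff_support_of_nonneg_ae]
  · have : Function.support c ∩ Set.Icc 0 1 = Set.Icc 0 1 :=
      Set.inter_eq_right.2 fun t ht => (h0 t ht).ne'
    rw [this, Real.volume_Icc_pi]
    simp
  · exact (ae_restrict_mem measurableSet_Icc).mono fun t ht => (h0 t ht).le
  · exact hc.integrableOn_compact isCompact_Icc

/-- The cube is connected, so `c` has constant sign. Thus non-vanishing of the form on vertical
bases suffices later, with no choice of orientation. -/
theorem setIntegral_Icc_ne_zero {m : ℕ} {c : (Fin m → ℝ) → ℝ} (hc : ContinuousOn c (Set.Icc 0 1))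
    (h0 : ∀ t ∈ Set.Icc (0 : Fin m → ℝ) 1, c t ≠ 0) : ∫ t in Set.Icc 0 1, c t ≠ 0 := by
  have hconn : IsPreconnected (Set.Icc (0 : Fin m → ℝ) 1) := (convex_Icc _ _).isPreconnected
  have key : (∀ t ∈ Set.Icc (0 : Fin m → ℝ) 1, 0 < c t) ∨
      ∀ t ∈ Set.Icc (0 : Fin m → ℝ) 1, 0 < -c t := by
    by_contra! H
    obtain ⟨⟨t, ht, hct⟩, s, hs, hcs⟩ := H
    obtain ⟨r, hr, hr0⟩ := hconn.intermediate_value ht hs hc ⟨hct, by linarith⟩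
    exact h0 r hr hr0
  rcases key with h | h
  · exact (setIntegral_Icc_pos hc h).ne'
  · have := setIntegral_Icc_pos (c := fun t => -c t) hc.neg h
    rw [integral_neg] at this
    linarith

theorem span_range_map_vecMul {m : ℕ} (M : Matrix.SpecialLinearGroup (Fin m) ℤ)
    (L : (Fin m → ℝ) ≃ₗ[ℝ] (Fin m → ℝ))
    (hL : ∀ t, L t = Matrix.vecMul t ((M : Matrix (Fin m) (Fin m) ℤ).map (Int.cast : ℤ → ℝ))) :
    Submodule.span ℤ (Set.range ((Pi.basisFun ℝ (Fin m)).map L)) =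
      Submodule.span ℤ (Set.range (Pi.basisFun ℝ (Fin m))) := by
  have hrow : ∀ i, L (Pi.single i 1) = ∑ j, M i j • (Pi.single j 1 : Fin m → ℝ) := fun i => by
    ext k
    simp [hL, Finset.sum_apply, Pi.single_apply]
  apply le_antisymm <;> rw [Submodule.span_le] <;> rintro _ ⟨i, rfl⟩
  · rw [Module.Basis.map_apply, Pi.basisFun_apply, hrow]
    exact Submodule.sum_mem _ fun j _ => Submodule.smul_mem _ _
      (Submodule.subset_span ⟨j, Pi.basisFun_apply _ _ _⟩)
  · have : (Pi.basisFun ℝ (Fin m)) i = ∑ j, (M⁻¹ : Matrix.SpecialLinearGroup _ ℤ) i j •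
        ((Pi.basisFun ℝ (Fin m)).map L) j := by
      simp only [Module.Basis.map_apply, Pi.basisFun_apply, hrow, Finset.smul_sum, smul_smul]
      rw [Finset.sum_comm]
      have h1 : ∀ k, ∑ j, (M⁻¹ : Matrix.SpecialLinearGroup _ ℤ) i j * M j k =
          (1 : Matrix _ _ ℤ) i k := fun k => by
        rw [← Matrix.mul_apply, ← Matrix.SpecialLinearGroup.coe_mul, inv_mul_cancel,
          Matrix.SpecialLinearGroup.coe_one]
      simp only [← Finset.sum_smul, h1, Matrix.one_apply, ite_smul, one_smul, zero_smul,
        Finset.sum_ite_eq, Finset.mem_univ, if_true]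
    rw [this]
    exact Submodule.sum_mem _ fun j _ => Submodule.smul_mem _ _ (Submodule.subset_span ⟨j, rfl⟩)

/-- Elements of `SL(m, ℤ)` preserve integrals over the torus `ℝᵐ / ℤᵐ`. -/
theorem setIntegral_vecMul_of_periodic {m : ℕ} (M : Matrix.SpecialLinearGroup (Fin m) ℤ)
    {c : (Fin m → ℝ) → ℝ} (hc : ∀ t j, c (t + Pi.single j 1) = c t) :
    ∫ t in Set.Icc 0 1, c (Matrix.vecMul t ((M : Matrix (Fin m) (Fin m) ℤ).map (Int.cast : ℤ → ℝ))) =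
      ∫ t in Set.Icc 0 1, c t := by
  set N := (M : Matrix (Fin m) (Fin m) ℤ).map (Int.cast : ℤ → ℝ) with hN
  have hdet : N.transpose.det = 1 := by
    have := (Int.castRingHom ℝ).map_det (M : Matrix (Fin m) (Fin m) ℤ)
    rw [M.det_coe] at this
    rw [Matrix.det_transpose]
    simpa using this.symm
  let L : (Fin m → ℝ) ≃ₗ[ℝ] (Fin m → ℝ) :=
    Matrix.toLin'OfInv (M := N.transpose⁻¹) (M' := N.transpose)
      (Matrix.nonsing_inv_mul _ (by simp [hdet])) (Matrix.mul_nonsing_inv _ (by simp [hdet]))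
  have hL : ∀ t, L t = Matrix.vecMul t N := fun t =>
    (Matrix.toLin'_apply N.transpose t).trans (Matrix.mulVec_transpose N t)
  have hLfun : ⇑L = ⇑(Matrix.toLin' N.transpose) := rfl
  have hmp : MeasurePreserving L volume volume := by
    refine ⟨L.toContinuousLinearEquiv.continuous.measurable, ?_⟩
    have := Real.map_matrix_volume_pi_eq_smul_volume_pi (M := N.transpose) (by simp [hdet])
    rw [hdet] at this
    rw [hLfun]
    simpa using this
  have hemb : MeasurableEmbedding L :=
    L.toContinuousLinearEquiv.toHomeomorph.measurableEmbedding
  set b := Pi.basisFun ℝ (Fin m)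
  have hD : ZSpan.fundamentalDomain b =ᵐ[volume] Set.Icc 0 1 := by
    rw [ZSpan.fundamentalDomain_pi_basisFun]
    exact Measure.univ_pi_Ico_ae_eq_Icc
  have hF1 := ZSpan.isAddFundamentalDomain' (b.map L) volume
  -- The image of the half-open cube under `L` is a fundamental domain for the same lattice `ℤᵐ`, so
  -- a periodic function has the same integral over it as over the cube.
  rw [span_range_map_vecMul M L hL, ← ZSpan.map_fundamentalDomain] at hF1
  have hF2 := ZSpan.isAddFundamentalDomain' b volume
  have hper : ∀ g ∈ Submodule.span ℤ (Set.range b), Function.Periodic c g := fun g hg => by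
    induction hg using Submodule.span_induction with
    | mem x hx =>
      obtain ⟨j, rfl⟩ := hx
      intro t
      rw [Pi.basisFun_apply]
      exact hc t j
    | zero => intro t; rw [add_zero]
    | add x y _ _ hx hy => exact hx.add_period hy
    | smul k x _ hx => exact hx.zsmul k
  have : Countable (Submodule.span ℤ (Set.range b)).toAddSubgroup :=
    inferInstanceAs (Countable (Submodule.span ℤ (Set.range b)))
  rw [← setIntegral_congr_set hD]
  simp only [← hL]
  rw [← hmp.setIntegral_image_emb hemb]
  refine Eq.trans (hF1.setIntegral_eq hF2 fun g x => ?_) (setIntegral_congr_set hD)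
  rw [AddSubgroup.vadd_def, vadd_eq_add, add_comm]
  exact hper g g.2 x

/-- The flux of a divergence-free vector field, periodic in all variables but the first, through
the unit cube does not depend on the first variable. -/
theorem setIntegral_eq_of_divergence_eq_zero {m : ℕ} {f : Fin (m + 1) → (Fin (m + 1) → ℝ) → ℝ}
    (hf : ∀ s : Fin (m + 1) → ℝ, 0 < s 0 → ∀ i, DifferentiableAt ℝ (f i) s)
    (hdiv : ∀ s : Fin (m + 1) → ℝ, 0 < s 0 → ∑ i, fderiv ℝ (f i) s (Pi.single i 1) = 0)
    (hper : ∀ s : Fin (m + 1) → ℝ, 0 < s 0 → ∀ i j, f i (s + Pi.single (Fin.succ j) 1) = f i s)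
    {y₁ y₂ : ℝ} (h₁ : 0 < y₁) (h₂ : y₁ ≤ y₂) :
    ∫ t in Set.Icc (0 : Fin m → ℝ) 1, f 0 (Fin.cons y₁ t) =
      ∫ t in Set.Icc (0 : Fin m → ℝ) 1, f 0 (Fin.cons y₂ t) := by
  let a : Fin (m + 1) → ℝ := Fin.cons y₁ 0
  let b : Fin (m + 1) → ℝ := Fin.cons y₂ 1
  have hle : a ≤ b := Fin.cases h₂ fun i => by simp [a, b]
  have hpos : ∀ s ∈ Set.Icc a b, 0 < s 0 := fun s hs => h₁.trans_le (hs.1 0)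
  have hzero : ∀ s ∈ Set.Icc a b, ∑ i, fderiv ℝ (f i) s (Pi.single i 1) = 0 :=
    fun s hs => hdiv s (hpos s hs)
  have key := integral_divergence_of_hasFDerivAt_off_countable' a b hle f
    (fun i s => fderiv ℝ (f i) s) ∅ Set.countable_empty
    (fun i s hs => (hf s (hpos s hs) i).continuousAt.continuousWithinAt)
    (fun s hs i => (hf s (hpos s ⟨fun j => (hs.1 j trivial).1.le, fun j => (hs.1 j trivial).2.le⟩)
      i).hasFDerivAt)
    ((integrableOn_congr_fun hzero measurableSet_Icc).2 integrableOn_zero)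
  rw [setIntegral_congr_fun measurableSet_Icc hzero, Fin.sum_univ_succ] at key
  -- Opposite lateral faces differ by a period and cancel; only the faces `y = y₁` and `y = y₂`
  -- remain.
  have hfaces : ∀ j : Fin m,
      (∫ x in Set.Icc (a ∘ Fin.succAbove j.succ) (b ∘ Fin.succAbove j.succ),
        f j.succ (Fin.insertNth j.succ (b j.succ) x)) =
      ∫ x in Set.Icc (a ∘ Fin.succAbove j.succ) (b ∘ Fin.succAbove j.succ),
        f j.succ (Fin.insertNth j.succ (a j.succ) x) := fun j => by
    refine setIntegral_congr_fun measurableSet_Icc fun x hx => ?_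
    have hmem : (Fin.insertNth j.succ (a j.succ) x : Fin (m + 1) → ℝ) ∈ Set.Icc a b :=
      Fin.insertNth_mem_Icc.2 ⟨⟨le_rfl, hle _⟩, hx⟩
    show f j.succ (Fin.insertNth j.succ (b j.succ) x) = f j.succ (Fin.insertNth j.succ (a j.succ) x)
    rw [← hper _ (hpos _ hmem) j.succ j]
    congr 1
    refine (Fin.forall_iff_succAbove j.succ).2 ⟨?_, fun i => ?_⟩ |> funext
    · simp [a, b]
    · simp [Fin.succAbove_ne]
  simp only [hfaces, sub_self, Finset.sum_const_zero, add_zero, integral_zero, Fin.insertNth_zero']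
    at key
  have h1 : ∀ y, (Fin.cons y (0 : Fin m → ℝ) : Fin (m + 1) → ℝ) ∘ Fin.succAbove 0 = 0 := fun y => by
    ext; simp
  have h2 : ∀ y, (Fin.cons y (1 : Fin m → ℝ) : Fin (m + 1) → ℝ) ∘ Fin.succAbove 0 = 1 := fun y => by
    ext; simp
  simp only [a, b, h1, h2, Fin.cons_zero] at key
  exact (sub_eq_zero.1 key.symm).symm

end BoxIntegrals

namespace Datum

variable {n : ℕ} (D : Datum n)

/-! ### Real coordinates adapted to the lattice -/

section Coordinates

/-- The real linear coordinates `(y, t) ↦ (i y, 0) + ∑ t_i u_i` on `ℂ × ℂⁿ`. -/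
def coordHom : ℝ × (Fin (2 * n + 1) → ℝ) →ₗ[ℝ] Model n :=
  ((LinearMap.id : ℝ →ₗ[ℝ] ℝ).smulRight ((Complex.I, 0) : Model n)).coprod
    (Fintype.linearCombination ℝ D.u)

theorem coordHom_apply (p : ℝ × (Fin (2 * n + 1) → ℝ)) :
    D.coordHom p = p.1 • ((Complex.I, 0) : Model n) + ∑ i, p.2 i • D.u i := by
  simp [coordHom, Fintype.linearCombination_apply]

theorem im_coordHom (p : ℝ × (Fin (2 * n + 1) → ℝ)) : (D.coordHom p).1.im = p.1 := by
  simp [coordHom_apply, u, Prod.fst_sum]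

theorem coordHom_injective : Function.Injective D.coordHom := by
  rw [← LinearMap.ker_eq_bot, LinearMap.ker_eq_bot']
  rintro p hp
  have h1 : p.1 = 0 := by rw [← im_coordHom, hp]; rfl
  rw [coordHom_apply, h1, zero_smul, zero_add] at hp
  exact Prod.ext h1 (D.eq_zero_of_sum_u p.2 hp)

theorem finrank_pi_complex : Module.finrank ℝ (Fin n → ℂ) = n * 2 := by
  rw [Module.finrank_pi_fintype]
  simp [Complex.finrank_real_complex]

theorem finrank_model : Module.finrank ℝ (Model n) = 2 + n * 2 := by
  rw [Module.finrank_prod, finrank_pi_complex, Complex.finrank_real_complex]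

/-- The real linear coordinates `(y, t) ↦ (i y, 0) + ∑ t_i u_i` on `ℂ × ℂⁿ`. -/
def coord : (ℝ × (Fin (2 * n + 1) → ℝ)) ≃ₗ[ℝ] Model n :=
  LinearEquiv.ofBijective D.coordHom ⟨D.coordHom_injective,
    (LinearMap.injective_iff_surjective_of_finrank_eq_finrank (by
      rw [finrank_model]; simp; ring)).1 D.coordHom_injective⟩

theorem coord_apply (p : ℝ × (Fin (2 * n + 1) → ℝ)) :
    D.coord p = p.1 • ((Complex.I, 0) : Model n) + ∑ i, p.2 i • D.u i :=
  D.coordHom_apply p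

theorem im_coord (p : ℝ × (Fin (2 * n + 1) → ℝ)) : (D.coord p).1.im = p.1 :=
  D.im_coordHom p

theorem coord_add_single (y : ℝ) (t : Fin (2 * n + 1) → ℝ) (j : Fin (2 * n + 1)) :
    D.coord (y, t + Pi.single j 1) = D.coord (y, t) + D.u j := by
  simp only [coord_apply, Pi.add_apply, add_smul, Finset.sum_add_distrib, add_assoc]
  congr 2
  simp [Pi.single_apply]

theorem coord_mem {y : ℝ} (hy : 0 < y) (t : Fin (2 * n + 1) → ℝ) :
    D.coord (y, t) ∈ HalfSpace n := by
  show 0 < (D.coord (y, t)).1.im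
  rwa [im_coord]

/-- The real matrix of the datum. -/
abbrev realMatrix : Matrix (Fin (2 * n + 1)) (Fin (2 * n + 1)) ℝ :=
  (D.M : Matrix (Fin (2 * n + 1)) (Fin (2 * n + 1)) ℤ).map (Int.cast : ℤ → ℝ)

/-- The linear part of `g_0` acts on the `u_i` through the integer matrix `M`, so in these
coordinates it splits into a scaling of the height and a toral automorphism. -/
theorem A_coord (y : ℝ) (t : Fin (2 * n + 1) → ℝ) :
    D.A (D.coord (y, t)) = D.coord (D.α * y, Matrix.vecMul t D.realMatrix) := by
  have hsmul : ∀ (r : ℝ) (p : Model n), D.A (r • p) = r • D.A p := fun r p =>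
    (D.A.toLinearMap.restrictScalars ℝ).map_smul r p
  simp only [coord_apply, map_add, map_sum, hsmul, A_u]
  congr 1
  · rw [A_apply]
    ext1
    · simp; ring
    · simp
  · simp only [Matrix.vecMul, dotProduct, Finset.sum_smul, Finset.smul_sum]
    rw [Finset.sum_comm]
    refine Finset.sum_congr rfl fun j _ => Finset.sum_congr rfl fun i _ => ?_
    rw [mul_smul]
    exact congrArg _ (Int.cast_smul_eq_zsmul ℝ (D.M i j) (D.u j)).symm

/-- The real linear map `z ↦ Rᵀ z`. -/
def fibreMap : (Fin n → ℂ) →ₗ[ℝ] (Fin n → ℂ) :=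
  (Matrix.toLin' D.R.transpose).restrictScalars ℝ

/-- The real determinant of `A` is computed twice. In the coordinates `(y, t)` it is `α · det M =
α`; on `ℂ × ℂⁿ` it is `α² · det fibreMap`, since the first factor has real dimension two. -/
theorem alpha_mul_det_fibreMap : D.α * LinearMap.det D.fibreMap = 1 := by
  have hdet : D.realMatrix.transpose.det = 1 := by
    have := (Int.castRingHom ℝ).map_det (D.M : Matrix (Fin (2 * n + 1)) (Fin (2 * n + 1)) ℤ)
    rw [D.M.det_coe] at this
    rw [Matrix.det_transpose]
    simpa using this.symm
  let K : Module.End ℝ (ℝ × (Fin (2 * n + 1) → ℝ)) :=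
    LinearMap.prodMap (D.α • LinearMap.id) (Matrix.toLin' D.realMatrix.transpose)
  have h1 : LinearMap.det K = D.α := by
    rw [LinearMap.det_prodMap, LinearMap.det_toLin', hdet, LinearMap.det_smul]
    simp
  let K' : Module.End ℝ (Model n) := LinearMap.prodMap (D.α • LinearMap.id) D.fibreMap
  have h2 : LinearMap.det K' = D.α ^ 2 * LinearMap.det D.fibreMap := by
    rw [LinearMap.det_prodMap, LinearMap.det_smul, Complex.finrank_real_complex]
    simp
  have h3 : K' = (D.coord : _ →ₗ[ℝ] Model n) ∘ₗ K ∘ₗ (D.coord.symm : Model n →ₗ[ℝ] _) := by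
    refine LinearMap.ext fun p => ?_
    obtain ⟨⟨y, t⟩, rfl⟩ := D.coord.surjective p
    have h := D.A_coord y t
    have hK' : ∀ p, K' p = D.A p := fun p => by
      rw [A_apply]
      ext1
      · exact Complex.real_smul
      · rfl
    rw [hK', h]
    simp [K, Matrix.mulVec_transpose]
  rw [h3, LinearMap.det_conj, h1] at h2
  have := D.α_pos.ne'
  field_simp at h2
  linarith

end Coordinates

/-! ### The flux of an invariant closed form through the tori -/

section Flux

open MeasureTheory

variable {φ : Model n → Model n [⋀^Fin (n * 2)]→L[ℝ] ℝ}

/-- The integral over a torus `y = const` of a `2n`-form evaluated on vertical vectors. -/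
def flux (φ : Model n → Model n [⋀^Fin (n * 2)]→L[ℝ] ℝ) (e : Fin (n * 2) → Fin n → ℂ) (y : ℝ) : ℝ :=
  ∫ t in Set.Icc (0 : Fin (2 * n + 1) → ℝ) 1, φ (D.coord (y, t)) fun i => (0, e i)

/-- Evaluating `dφ = 0` on the constant vectors `(I, 0), (0, e_1), …, (0, e_{2n})` expresses the
vanishing of the divergence of a vector field whose height component is the integrand of the flux.
-/
theorem flux_eq_of_le (hφ : ∀ p ∈ HalfSpace n, DifferentiableAt ℝ φ p)
    (hd : ∀ p ∈ HalfSpace n, extDeriv φ p = 0)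
    (hu : ∀ p ∈ HalfSpace n, ∀ i, φ (p + D.u i) = φ p) (e : Fin (n * 2) → Fin n → ℂ) {y₁ y₂ : ℝ}
    (h₁ : 0 < y₁) (h₂ : y₁ ≤ y₂) : D.flux φ e y₁ = D.flux φ e y₂ := by
  let split : (Fin (2 * n + 1 + 1) → ℝ) →ₗ[ℝ] ℝ × (Fin (2 * n + 1) → ℝ) :=
    (LinearMap.proj 0).prod (LinearMap.pi fun i => LinearMap.proj i.succ)
  let F : (Fin (2 * n + 1 + 1) → ℝ) →L[ℝ] Model n :=
    LinearMap.toContinuousLinearMap (D.coord.toLinearMap ∘ₗ split)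
  have hF : ∀ s, F s = D.coord (s 0, fun i => s i.succ) := fun s => rfl
  have hFmem : ∀ s : Fin (2 * n + 1 + 1) → ℝ, 0 < s 0 → F s ∈ HalfSpace n := fun s hs =>
    D.coord_mem hs _
  let v : Fin (n * 2 + 1) → Model n := Fin.cons (Complex.I, 0) fun i => (0, e i)
  let T : Fin (n * 2 + 1) → Fin (2 * n + 1 + 1) → ℝ := fun i =>
    Fin.cons (D.coord.symm (v i)).1 (D.coord.symm (v i)).2
  have hFT : ∀ i, F (T i) = v i := fun i => D.coord.apply_symm_apply (v i)
  have hT0 : ∀ i, T i 0 = (v i).1.im := fun i => by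
    conv_rhs => rw [← hFT i, hF, im_coord]
  let G : Fin (n * 2 + 1) → Model n → ℝ := fun i p => φ p (i.removeNth v)
  have hG : ∀ i, ∀ p ∈ HalfSpace n, DifferentiableAt ℝ (G i) p := fun i p hp =>
    (ContinuousAlternatingMap.apply ℝ (Model n) ℝ (i.removeNth v)).differentiableAt.comp p (hφ p hp)
  have hGF : ∀ i, ∀ s : Fin (2 * n + 1 + 1) → ℝ, 0 < s 0 →
      HasFDerivAt (fun s => G i (F s)) ((fderiv ℝ (G i) (F s)).comp F) s := fun i s hs =>
    (hG i _ (hFmem s hs)).hasFDerivAt.comp s F.hasFDerivAt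
  -- This is the field `∑ i, (-1)^i G_i T_i`, where `T i` is `v i` in coordinates and `G i` is `φ`
  -- on the remaining vectors. Only `v 0` has a first entry with non-zero imaginary part, so the
  -- component along `y` is `G 0`.
  let f : Fin (2 * n + 1 + 1) → (Fin (2 * n + 1 + 1) → ℝ) → ℝ := fun j s =>
    ∑ i, (-1) ^ i.val * T i j * G i (F s)
  have hf : ∀ j, ∀ s : Fin (2 * n + 1 + 1) → ℝ, 0 < s 0 →
      HasFDerivAt (f j) (∑ i, ((-1) ^ i.val * T i j) • (fderiv ℝ (G i) (F s)).comp F) s :=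
    fun j s hs => HasFDerivAt.fun_sum fun i _ => (hGF i s hs).const_mul _
  have hf0 : ∀ s, f 0 s = φ (F s) fun i => (0, e i) := fun s => by
    simp only [f, hT0]
    rw [Fin.sum_univ_succ]
    simp [v, G]
  have key := setIntegral_eq_of_divergence_eq_zero (f := f)
    (fun s hs j => (hf j s hs).differentiableAt) (fun s hs => ?_) (fun s hs j k => ?_) h₁ h₂
  · simpa only [hf0, hF, Fin.cons_zero, Fin.cons_succ, flux] using key
  · have h0 : extDeriv φ (F s) v = 0 := by rw [hd _ (hFmem s hs)]; rfl
    rw [extDeriv_apply (hφ _ (hFmem s hs))] at h0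
    rw [← h0]
    simp only [fun j => (hf j s hs).fderiv, sum_apply]
    rw [Finset.sum_comm]
    refine Finset.sum_congr rfl fun i _ => ?_
    rw [← hFT i]
    conv_rhs => rw [← Finset.univ_sum_single (T i)]
    simp only [map_sum, Finset.smul_sum]
    refine Finset.sum_congr rfl fun j _ => ?_
    have : (Pi.single j (T i j) : Fin (2 * n + 1 + 1) → ℝ) = T i j • Pi.single j 1 := by
      rw [← Pi.single_smul', smul_eq_mul, mul_one]
    rw [this, map_smul, map_smul]
    simp [G, mul_assoc]
  · have : F (s + Pi.single k.succ 1) = F s + D.u k := by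
      rw [hF, hF, ← coord_add_single]
      congr 2
      · simp
      · ext i
        simp [Pi.single_apply]
    simp only [f, G, this, hu _ (hFmem s hs)]

/-- By invariance the integrand at `(y, t)` is `φ` at `(α y, t M)` on the vectors `A (0, e_i)`. A
top-degree form on the fibre turns these into the factor `det fibreMap`, and the toral automorphism
`t ↦ t M` does not change the integral. -/
theorem flux_mul (hu : ∀ p ∈ HalfSpace n, ∀ i, φ (p + D.u i) = φ p)
    (hA : ∀ p ∈ HalfSpace n, ∀ v, φ (D.A p) (fun i => D.A (v i)) = φ p v)
    (e : Module.Basis (Fin (n * 2)) ℝ (Fin n → ℂ)) {y : ℝ} (hy : 0 < y) :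
    D.flux φ e y = LinearMap.det D.fibreMap * D.flux φ e (D.α * y) := by
  have hy' := mul_pos D.α_pos hy
  have hdet : ∀ q : Model n, φ q (fun i => D.A (0, e i)) =
      LinearMap.det D.fibreMap * φ q fun i => (0, e i) := fun q => by
    let ψ : (Fin n → ℂ) [⋀^Fin (n * 2)]→ₗ[ℝ] ℝ :=
      (φ q).toAlternatingMap.compLinearMap (LinearMap.inr ℝ ℂ (Fin n → ℂ))
    have h1 : ∀ i, D.A (0, e i) = (0, D.fibreMap (e i)) := fun i => by
      rw [A_apply]
      ext1
      · simp
      · rfl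
    simp only [h1]
    have h2 : ψ (D.fibreMap ∘ e) = LinearMap.det D.fibreMap * ψ e := by
      rw [ψ.eq_smul_basis_det e]
      simp [Module.Basis.det_comp]
      ring
    exact h2
  rw [flux, flux, ← setIntegral_vecMul_of_periodic D.M
    (c := fun t => φ (D.coord (D.α * y, t)) fun i => (0, e i)), ← integral_const_mul]
  · refine setIntegral_congr_fun measurableSet_Icc fun t _ => ?_
    show φ (D.coord (y, t)) _ = _
    rw [← hA _ (D.coord_mem hy t), hdet, A_coord]
  · intro t j
    rw [coord_add_single, hu _ (D.coord_mem hy' t)]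

/-- There is no closed `G_M`-invariant `2n`-form on `ℍ × ℂⁿ` which is non-degenerate on the
vertical spaces `ℂⁿ`. -/
theorem false_of_closed_invariant_form (hφ : ∀ p ∈ HalfSpace n, DifferentiableAt ℝ φ p)
    (hd : ∀ p ∈ HalfSpace n, extDeriv φ p = 0)
    (hu : ∀ p ∈ HalfSpace n, ∀ i, φ (p + D.u i) = φ p)
    (hA : ∀ p ∈ HalfSpace n, ∀ v, φ (D.A p) (fun i => D.A (v i)) = φ p v)
    (hne : ∀ p ∈ HalfSpace n, ∀ e : Module.Basis (Fin (n * 2)) ℝ (Fin n → ℂ),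
      φ p (fun i => (0, e i)) ≠ 0) : False := by
  let e : Module.Basis (Fin (n * 2)) ℝ (Fin n → ℂ) :=
    Module.finBasisOfFinrankEq ℝ (Fin n → ℂ) finrank_pi_complex
  have h1 : D.flux φ e 1 = D.flux φ e (D.α * 1) := by
    have hα := D.α_pos
    -- `α` may lie on either side of `1`.
    rcases le_total 1 (D.α * 1) with h | h
    · exact D.flux_eq_of_le hφ hd hu e one_pos h
    · exact (D.flux_eq_of_le hφ hd hu e (by linarith) h).symm
  have h2 := D.flux_mul hu hA e one_pos
  rw [← h1] at h2
  have h3 : D.flux φ e 1 ≠ 0 := by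
    refine setIntegral_Icc_ne_zero (fun t _ => ContinuousAt.continuousWithinAt ?_)
      fun t _ => hne _ (D.coord_mem one_pos t) e
    have hc : Continuous fun t : Fin (2 * n + 1) → ℝ => D.coord (1, t) :=
      (LinearMap.continuous_of_finiteDimensional D.coord.toLinearMap).comp (by fun_prop)
    have h4 : ContinuousAt (fun t => φ (D.coord (1, t))) t :=
      ContinuousAt.comp (f := fun t => D.coord (1, t)) (g := φ)
        (hφ _ (D.coord_mem one_pos t)).continuousAt hc.continuousAt
    exact (ContinuousAlternatingMap.apply ℝ (Model n) ℝ
      fun i => ((0, e i) : Model n)).continuous.continuousAt.comp h4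
  have h5 : LinearMap.det D.fibreMap = 1 := mul_right_cancel₀ h3 (by rw [one_mul]; exact h2.symm)
  have h6 := D.alpha_mul_det_fibreMap
  rw [h5, mul_one] at h6
  exact D.α_ne_one h6

end Flux

end Datum

/-! ### Differentiability of forms and of pulled-back metrics -/

theorem two_le_infty : (2 : WithTop ℕ∞) ≤ ∞ :=
  WithTop.coe_le_coe.2 (le_top : (2 : ℕ∞) ≤ ⊤)

/-- An alternating map is determined by its values on tuples of basis vectors, and it is recovered
from those finitely many values by a linear left inverse. -/
theorem differentiableAt_continuousAlternatingMap {E Y ι : Type*} [NormedAddCommGroup E]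
    [NormedSpace ℝ E] [FiniteDimensional ℝ E] [NormedAddCommGroup Y] [NormedSpace ℝ Y] [Fintype ι]
    {f : Y → E [⋀^ι]→L[ℝ] ℝ} {y : Y} (h : ∀ v, DifferentiableAt ℝ (fun z => f z v) y) :
    DifferentiableAt ℝ f y := by
  classical
  let b := Module.finBasis ℝ E
  let L : (E [⋀^ι]→L[ℝ] ℝ) →ₗ[ℝ] (ι → Fin (Module.finrank ℝ E)) → ℝ :=
    { toFun := fun η s => η fun i => b (s i)
      map_add' := fun _ _ => rfl
      map_smul' := fun _ _ => rfl }
  have hL : LinearMap.ker L = ⊥ := by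
    rw [LinearMap.ker_eq_bot']
    intro η hη
    apply ContinuousAlternatingMap.toAlternatingMap_injective
    refine Module.Basis.ext_alternating b fun s _ => ?_
    exact congrFun hη s
  obtain ⟨g, hg⟩ := L.exists_leftInverse_of_injective hL
  have hfg : f = fun z => LinearMap.toContinuousLinearMap g (L (f z)) := by
    funext z
    exact (LinearMap.congr_fun hg (f z)).symm
  rw [hfg]
  exact (LinearMap.toContinuousLinearMap g).differentiableAt.comp y
    (differentiableAt_pi.2 fun s => h fun i => b (s i))

section Manifold

variable {E : Type*} [NormedAddCommGroup E] [NormedSpace ℝ E] [NormedSpace ℂ E]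
  {X : Type*} [TopologicalSpace X] [ChartedSpace E X]
  [IsManifold 𝓘(ℝ, E) ∞ X]

-- For constant `v`, the map `z ↦ dP_z v` is a `C¹` section of the tangent bundle along `P`, and the
-- metric is a smooth section as well. The bundle formulation is needed because the coordinates on
-- `T_{P z} X` come from the preferred chart at `P z`, which need not vary continuously with `z`.
open Bundle in
theorem HermitianMetric.differentiableAt_inner_mfderiv (Ω : HermitianMetric E X) {P : E → X}
    {U : Set E} (hU : IsOpen U) (hP : ContMDiffOn 𝓘(ℝ, E) 𝓘(ℝ, E) ∞ P U) {y : E} (hy : y ∈ U)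
    (v w : E) : DifferentiableAt ℝ (fun z => Ω.inner (P z) (mfderiv 𝓘(ℝ, E) 𝓘(ℝ, E) P z v)
      (mfderiv 𝓘(ℝ, E) 𝓘(ℝ, E) P z w)) y := by
  have hvec : ∀ v : E, ContMDiffAt 𝓘(ℝ, E) 𝓘(ℝ, E).tangent 1
      (fun z => TotalSpace.mk' E (E := fun x : X => TangentSpace 𝓘(ℝ, E) x) (P z)
        (mfderiv 𝓘(ℝ, E) 𝓘(ℝ, E) P z v)) y := fun v => by
    have h1 := hP.contMDiffOn_tangentMapWithin (m := 1) two_le_infty hU.uniqueMDiffOn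
    have h2 : ContMDiffAt 𝓘(ℝ, E).tangent 𝓘(ℝ, E).tangent 1
        (tangentMapWithin 𝓘(ℝ, E) 𝓘(ℝ, E) P U) (⟨y, v⟩ : TangentBundle 𝓘(ℝ, E) E) :=
      h1.contMDiffAt ((hU.preimage (FiberBundle.continuous_proj E _)).mem_nhds hy)
    have h3 : ContMDiffAt 𝓘(ℝ, E) 𝓘(ℝ, E).tangent 1
        (fun z : E => (⟨z, v⟩ : TangentBundle 𝓘(ℝ, E) E)) y :=
      contMDiffAt_vectorSpace_iff_contDiffAt.2 contDiffAt_const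
    refine (ContMDiffAt.comp y h2 h3).congr_of_eventuallyEq ?_
    filter_upwards [hU.mem_nhds hy] with z hz
    simp only [Function.comp, tangentMapWithin, mfderivWithin_of_isOpen hU hz]
  have hPy : ContMDiffAt 𝓘(ℝ, E) 𝓘(ℝ, E) 1 P y :=
    (hP.contMDiffAt (hU.mem_nhds hy)).of_le (by norm_num)
  have hg := (Ω.contMDiff.of_le (m := 1) (by norm_num)).contMDiffAt.comp y hPy
  have key : ContMDiffAt 𝓘(ℝ, E) (𝓘(ℝ, E).prod 𝓘(ℝ)) 1
      (fun z ↦ TotalSpace.mk' ℝ (E := Bundle.Trivial X ℝ) (P z) (Ω.inner (P z)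
        (mfderiv 𝓘(ℝ, E) 𝓘(ℝ, E) P z v) (mfderiv 𝓘(ℝ, E) 𝓘(ℝ, E) P z w))) y := by
    apply ContMDiffAt.clm_bundle_apply₂ (F₁ := E) (F₂ := E)
    · exact hg
    · exact hvec v
    · exact hvec w
  simp only [contMDiffAt_totalSpace] at key
  exact (contMDiffAt_iff_contDiffAt.1 key.2).differentiableAt (by norm_num)

end Manifold

namespace Datum

variable {n : ℕ} (D : Datum n)

/-! ### The covering map and its derivative -/

section Cover

open Classical in
/-- The projection `ℍ × ℂⁿ → T_M`, extended by a constant to `ℂ × ℂⁿ`. -/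
def cover (p : Model n) : D.T :=
  if h : p ∈ HalfSpace n then D.proj ⟨p, h⟩
  else D.proj ⟨(Complex.I, 0), show 0 < Complex.I.im by simp⟩

theorem cover_of_mem {p : Model n} (h : p ∈ HalfSpace n) : D.cover p = D.proj ⟨p, h⟩ :=
  dif_pos h

/-- The affine map `z ↦ A^k z + ∑ v_i u_i`. -/
def affine (k : ℤ) (v : Fin (2 * n + 1) → ℤ) (z : Model n) : Model n :=
  (D.A ^ k) z + D.lat v

/-- The real linear map `A^k`. -/
def realPow (k : ℤ) : Model n →L[ℝ] Model n :=
  ((D.A ^ k : Model n ≃L[ℂ] Model n) : Model n →L[ℂ] Model n).restrictScalars ℝ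

theorem realPow_injective (k : ℤ) : Function.Injective (D.realPow k) :=
  (D.A ^ k : Model n ≃L[ℂ] Model n).injective

theorem hasFDerivAt_affine (k : ℤ) (v : Fin (2 * n + 1) → ℤ) (z : Model n) :
    HasFDerivAt (D.affine k v) (D.realPow k) z :=
  (D.realPow k).hasFDerivAt.add_const _

theorem contDiff_affine (k : ℤ) (v : Fin (2 * n + 1) → ℤ) : ContDiff ℝ ∞ (D.affine k v) :=
  (D.realPow k).contDiff.add contDiff_const

/-- `affine k v` restricts to a deck transformation of `ℍ × ℂⁿ → T_M`. -/
def IsDeck (k : ℤ) (v : Fin (2 * n + 1) → ℤ) : Prop :=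
  ∀ z ∈ HalfSpace n, D.affine k v z ∈ HalfSpace n ∧ D.cover (D.affine k v z) = D.cover z

theorem isDeck_of_smul {γ : D.G} {k : ℤ} {v : Fin (2 * n + 1) → ℤ}
    (hγ : ∀ p : HalfSpace n, (γ • p : HalfSpace n).1 = (D.A ^ k) p.1 + D.lat v) :
    D.IsDeck k v := by
  intro z hz
  have h1 : D.affine k v z = (γ • (⟨z, hz⟩ : HalfSpace n)).1 := (hγ ⟨z, hz⟩).symm
  have h2 : D.affine k v z ∈ HalfSpace n := by
    rw [h1]
    exact (γ • (⟨z, hz⟩ : HalfSpace n)).2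
  refine ⟨h2, ?_⟩
  rw [D.cover_of_mem h2, D.cover_of_mem hz]
  refine Quotient.sound ⟨γ, Subtype.ext h1.symm⟩

theorem isDeck_one : D.IsDeck 1 0 :=
  D.isDeck_of_smul (γ := ⟨D.g₀, Subgroup.subset_closure (Set.mem_insert _ _)⟩) fun p => by
    rw [zpow_one]
    simp only [lat, Pi.zero_apply, zero_smul, Finset.sum_const_zero, add_zero]
    rfl

theorem lat_single (i : Fin (2 * n + 1)) : D.lat (Pi.single i 1) = D.u i := by
  simp [lat, Pi.single_apply]

theorem isDeck_single (i : Fin (2 * n + 1)) : D.IsDeck 0 (Pi.single i 1) :=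
  D.isDeck_of_smul (γ := ⟨D.g i, Subgroup.subset_closure (Or.inr ⟨i, rfl⟩)⟩) fun p => by
    rw [lat_single]
    rfl

theorem chartAt_symm_eq_cover (x : D.T) {z : Model n} (hz : z ∈ (chartAt (Model n) x).target) :
    z ∈ HalfSpace n ∧ (chartAt (Model n) x).symm z = D.cover z := by
  obtain ⟨-, -, -, h⟩ := D.exists_localInverse (chart_mem_atlas (Model n) x)
  obtain ⟨h1, h2⟩ := h z hz
  exact ⟨h1, by rw [h2, D.cover_of_mem h1]⟩

/-- Charts of `T_M` are local inverses of the projection, so the chart value of the image of `p`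
lies in the same `G_M`-orbit as `p`. -/
theorem exists_isDeck_eq_chartAt {p : Model n} (hp : p ∈ HalfSpace n) :
    ∃ k v, D.IsDeck k v ∧ D.affine k v p = chartAt (Model n) (D.cover p) (D.cover p) := by
  set x := D.cover p
  have hmem := mem_chart_target (Model n) x
  obtain ⟨h1, h2⟩ := D.chartAt_symm_eq_cover x hmem
  have h3 : D.proj ⟨chartAt (Model n) x x, h1⟩ = D.proj ⟨p, hp⟩ := by
    rw [← D.cover_of_mem h1, ← D.cover_of_mem hp, ← h2]
    exact (chartAt (Model n) x).left_inv (mem_chart_source _ x)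
  obtain ⟨γ, hγ⟩ := Quotient.exact h3
  obtain ⟨k, v, hkv⟩ := D.normal_form γ
  refine ⟨k, v, D.isDeck_of_smul hkv, ?_⟩
  have h4 := hkv ⟨p, hp⟩
  have h5 : (γ • (⟨p, hp⟩ : HalfSpace n)) = ⟨_, h1⟩ := hγ
  rw [h5] at h4
  exact h4.symm

theorem eventually_cover_eq {p : Model n} (hp : p ∈ HalfSpace n) {k : ℤ}
    {v : Fin (2 * n + 1) → ℤ} (hkv : D.IsDeck k v)
    (hp' : D.affine k v p = chartAt (Model n) (D.cover p) (D.cover p)) :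
    ∀ᶠ z in 𝓝 p, D.affine k v z ∈ (chartAt (Model n) (D.cover p)).target ∧
      D.cover z = (chartAt (Model n) (D.cover p)).symm (D.affine k v z) := by
  have h1 : ∀ᶠ z in 𝓝 p, D.affine k v z ∈ (chartAt (Model n) (D.cover p)).target :=
    (D.contDiff_affine k v).continuous.continuousAt.eventually
      ((chartAt (Model n) (D.cover p)).open_target.mem_nhds
        (by rw [hp']; exact mem_chart_target _ _))
  filter_upwards [h1, (HalfSpace n).isOpen.mem_nhds hp] with z hz hzH
  exact ⟨hz, by rw [(D.chartAt_symm_eq_cover _ hz).2, (hkv z hzH).2]⟩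

theorem contMDiffOn_cover :
    ContMDiffOn 𝓘(ℝ, Model n) 𝓘(ℝ, Model n) ∞ D.cover (HalfSpace n) := by
  intro p hp
  obtain ⟨k, v, hkv, hp'⟩ := D.exists_isDeck_eq_chartAt hp
  have h1 : ContMDiffAt 𝓘(ℝ, Model n) 𝓘(ℝ, Model n) ∞ (chartAt (Model n) (D.cover p)).symm
      (D.affine k v p) := by
    refine contMDiffOn_chart_symm.contMDiffAt
      ((chartAt (Model n) (D.cover p)).open_target.mem_nhds ?_)
    rw [hp']
    exact mem_chart_target _ _
  refine ContMDiffAt.contMDiffWithinAt ?_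
  refine (ContMDiffAt.comp p h1 (D.contDiff_affine k v).contMDiff.contMDiffAt).congr_of_eventuallyEq
    ?_
  filter_upwards [D.eventually_cover_eq hp hkv hp'] with z hz
  exact hz.2

theorem contMDiffAt_cover {p : Model n} (hp : p ∈ HalfSpace n) :
    ContMDiffAt 𝓘(ℝ, Model n) 𝓘(ℝ, Model n) ∞ D.cover p :=
  D.contMDiffOn_cover.contMDiffAt ((HalfSpace n).isOpen.mem_nhds hp)

/-- The derivative of the projection, in the coordinates of the tangent bundle of `T_M`. -/
def coverDeriv (p : Model n) : Model n →L[ℝ] Model n :=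
  mfderiv 𝓘(ℝ, Model n) 𝓘(ℝ, Model n) D.cover p

/-- Read in the preferred chart at the image of `p`, the projection is an affine deck transformation
near `p`. Hence the derivative is complex linear and injective; the exponent `k` depends on `p`. -/
theorem exists_coverDeriv_eq {p : Model n} (hp : p ∈ HalfSpace n) :
    ∃ k, D.coverDeriv p = D.realPow k := by
  obtain ⟨k, v, hkv, hp'⟩ := D.exists_isDeck_eq_chartAt hp
  refine ⟨k, ?_⟩
  have h : HasMFDerivAt 𝓘(ℝ, Model n) 𝓘(ℝ, Model n) D.cover p (D.realPow k) := by
    refine ⟨(D.contMDiffAt_cover hp).continuousAt, ?_⟩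
    refine ((D.hasFDerivAt_affine k v p).congr_of_eventuallyEq ?_).hasFDerivWithinAt
    filter_upwards [D.eventually_cover_eq hp hkv hp'] with z hz
    show chartAt (Model n) (D.cover p) (D.cover z) = _
    rw [hz.2, (chartAt (Model n) (D.cover p)).right_inv hz.1]
  exact h.mfderiv

theorem coverDeriv_injective {p : Model n} (hp : p ∈ HalfSpace n) :
    Function.Injective (D.coverDeriv p) := by
  obtain ⟨k, h⟩ := D.exists_coverDeriv_eq hp
  rw [h]
  exact D.realPow_injective k

theorem coverDeriv_I_smul {p : Model n} (hp : p ∈ HalfSpace n) (v : Model n) :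
    D.coverDeriv p (Complex.I • v) = Complex.I • D.coverDeriv p v := by
  obtain ⟨k, h⟩ := D.exists_coverDeriv_eq hp
  rw [h]
  exact (D.A ^ k : Model n ≃L[ℂ] Model n).map_smul _ _

theorem coverDeriv_affine {k : ℤ} {v : Fin (2 * n + 1) → ℤ} (hkv : D.IsDeck k v) {p : Model n}
    (hp : p ∈ HalfSpace n) :
    D.coverDeriv p = (D.coverDeriv (D.affine k v p)).comp (D.realPow k) := by
  have h1 : HasMFDerivAt 𝓘(ℝ, Model n) 𝓘(ℝ, Model n) (D.affine k v) p (D.realPow k) :=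
    (D.hasFDerivAt_affine k v p).hasMFDerivAt
  have h2 := (((D.contMDiffAt_cover (hkv p hp).1).mdifferentiableAt (by norm_num)).hasMFDerivAt).comp
    p h1
  have h3 := h2.congr_of_eventuallyEq (f₁ := D.cover) (by
    filter_upwards [(HalfSpace n).isOpen.mem_nhds hp] with z hz
    exact (hkv z hz).2.symm)
  exact h3.mfderiv

end Cover

/-! ### The pullback of the metric and of the powers of its fundamental form -/

section PullbackForm

variable {D}
variable (Ω : HermitianMetric (Model n) D.T)

/-- The metric at `x`, in the coordinates of the tangent bundle. -/
def innerAt (x : D.T) : Model n →L[ℝ] Model n →L[ℝ] ℝ := Ω.inner x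

theorem innerAt_symm (x : D.T) (v w : Model n) : innerAt Ω x v w = innerAt Ω x w v :=
  Ω.symm x v w

theorem innerAt_pos (x : D.T) {v : Model n} (hv : v ≠ 0) : 0 < innerAt Ω x v v :=
  Ω.pos x v hv

theorem innerAt_I_smul (x : D.T) (v w : Model n) :
    innerAt Ω x (Complex.I • v) (Complex.I • w) = innerAt Ω x v w :=
  Ω.inner_J x v w

/-- The fundamental form at `x`, in the coordinates of the tangent bundle. -/
def formAt (x : D.T) : Model n →L[ℝ] Model n →L[ℝ] ℝ := Ω.fundamentalForm x

theorem formAt_apply (x : D.T) (v w : Model n) :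
    formAt Ω x v w = innerAt Ω x (Complex.I • v) w :=
  rfl

/-- The pullback of the metric to `ℍ × ℂⁿ`. -/
def pullbackInner (p : Model n) : Model n →L[ℝ] Model n →L[ℝ] ℝ :=
  (innerAt Ω (D.cover p)).bilinearComp (D.coverDeriv p) (D.coverDeriv p)

theorem pullbackInner_apply (p v w : Model n) : pullbackInner Ω p v w =
    innerAt Ω (D.cover p) (D.coverDeriv p v) (D.coverDeriv p w) :=
  rfl

/-- The pullback of the fundamental form to `ℍ × ℂⁿ`. -/
def pullbackForm (p : Model n) : Model n →L[ℝ] Model n →L[ℝ] ℝ :=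
  (formAt Ω (D.cover p)).bilinearComp (D.coverDeriv p) (D.coverDeriv p)

/-- The pullback of `ω^k` to `ℍ × ℂⁿ`. -/
def pullbackPow (k : ℕ) (p : Model n) : Model n [⋀^Fin (k * 2)]→L[ℝ] ℝ :=
  (wedgePow (formAt Ω (D.cover p)) k).compContinuousLinearMap (D.coverDeriv p)

theorem pullbackPow_eq (k : ℕ) (p : Model n) :
    pullbackPow Ω k p = wedgePow (pullbackForm Ω p) k :=
  wedgePow_compContinuousLinearMap _ _ _

theorem pullbackForm_apply {p : Model n} (hp : p ∈ HalfSpace n) (v w : Model n) :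
    pullbackForm Ω p v w = pullbackInner Ω p (Complex.I • v) w := by
  rw [pullbackInner_apply, D.coverDeriv_I_smul hp, ← formAt_apply]
  rfl

theorem pullbackInner_symm (p v w : Model n) : pullbackInner Ω p v w = pullbackInner Ω p w v := by
  rw [pullbackInner_apply, innerAt_symm, ← pullbackInner_apply]

theorem pullbackInner_pos {p : Model n} (hp : p ∈ HalfSpace n) {v : Model n} (hv : v ≠ 0) :
    0 < pullbackInner Ω p v v := by
  rw [pullbackInner_apply]
  exact innerAt_pos Ω _ fun h => hv (D.coverDeriv_injective hp (h.trans (map_zero _).symm))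

theorem pullbackInner_I_smul {p : Model n} (hp : p ∈ HalfSpace n) (v w : Model n) :
    pullbackInner Ω p (Complex.I • v) (Complex.I • w) = pullbackInner Ω p v w := by
  rw [pullbackInner_apply, D.coverDeriv_I_smul hp, D.coverDeriv_I_smul hp, innerAt_I_smul,
    ← pullbackInner_apply]

/-- The vertical space is a complex subspace of dimension `n`, so the pulled-back metric restricts
to a Hermitian one there, with `ω^n` the top power of its fundamental form. -/
theorem pullbackPow_ne_zero {p : Model n} (hp : p ∈ HalfSpace n)
    (e : Module.Basis (Fin (n * 2)) ℝ (Fin n → ℂ)) : pullbackPow Ω n p (fun i => (0, e i)) ≠ 0 := by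
  let ι := ContinuousLinearMap.inr ℝ ℂ (Fin n → ℂ)
  have h1 : pullbackPow Ω n p (fun i => (0, e i)) =
      wedgePow ((pullbackForm Ω p).bilinearComp ι ι) n e := by
    rw [pullbackPow_eq, ← wedgePow_compContinuousLinearMap]
    rfl
  have hI : ∀ v : Fin n → ℂ, ((0, Complex.I • v) : Model n) = Complex.I • (0, v) := fun v => by
    simp
  rw [h1]
  refine wedgePow_ne_zero (g := (pullbackInner Ω p).bilinearComp ι ι) (by simp)
    (fun v w => pullbackInner_symm Ω p _ _) (fun v hv => pullbackInner_pos Ω hp ?_)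
    (fun v w => ?_) (fun v w => ?_) e
  · exact fun h => hv (congrArg Prod.snd h)
  · show pullbackInner Ω p (0, Complex.I • v) (0, Complex.I • w) = _
    rw [hI, hI, pullbackInner_I_smul Ω hp]
    rfl
  · show pullbackForm Ω p (0, v) (0, w) = pullbackInner Ω p (0, Complex.I • v) (0, w)
    rw [pullbackForm_apply Ω hp, hI]

/-- Invariance under deck transformations: the chain rule applied to `cover ∘ affine k v = cover`.
-/
theorem pullbackPow_affine (m : ℕ) {k : ℤ} {v : Fin (2 * n + 1) → ℤ} (hkv : D.IsDeck k v)
    {p : Model n} (hp : p ∈ HalfSpace n) :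
    pullbackPow Ω m p =
      (pullbackPow Ω m (D.affine k v p)).compContinuousLinearMap (D.realPow k) := by
  rw [pullbackPow, pullbackPow, (hkv p hp).2, D.coverDeriv_affine hkv hp]
  rfl

theorem differentiableAt_pullbackPow (k : ℕ) {p : Model n} (hp : p ∈ HalfSpace n) :
    DifferentiableAt ℝ (pullbackPow Ω k) p := by
  have h1 : ∀ v w, DifferentiableAt ℝ (fun z => pullbackForm Ω z v w) p := fun v w => by
    refine (Ω.differentiableAt_inner_mfderiv (HalfSpace n).isOpen D.contMDiffOn_cover hp
      (Complex.I • v) w).congr_of_eventuallyEq ?_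
    filter_upwards [(HalfSpace n).isOpen.mem_nhds hp] with z hz
    exact pullbackForm_apply Ω hz v w
  refine differentiableAt_continuousAlternatingMap fun v => ?_
  simp only [pullbackPow_eq, wedgePow_apply]
  refine DifferentiableAt.const_mul (DifferentiableAt.fun_sum fun σ _ => ?_) _
  refine DifferentiableAt.const_mul ?_ _
  exact (HasFDerivAt.finsetProd fun i _ => (h1 _ _).hasFDerivAt).differentiableAt

/-- The hypothesis at `x` concerns only the point `chartAt x x`, where the pullback agrees locally
with the chart expression of the form. Deck invariance and naturality of the exterior derivative
carry the vanishing from there to `p`. -/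
theorem extDeriv_pullbackPow {k : ℕ} (hΩ : ∀ x, mextDeriv (Ω.fundamentalPow k) x = 0) {p : Model n}
    (hp : p ∈ HalfSpace n) : extDeriv (pullbackPow Ω k) p = 0 := by
  obtain ⟨l, v, hlv, hp'⟩ := D.exists_isDeck_eq_chartAt hp
  set x := D.cover p
  have h1 : extDeriv (pullbackPow Ω k) (D.affine l v p) = 0 := by
    rw [hp']
    refine Eq.trans (Filter.EventuallyEq.extDeriv_eq ?_) (hΩ x)
    filter_upwards [(chartAt (Model n) x).open_target.mem_nhds (mem_chart_target _ x)] with z hz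
    have h2 : D.cover =ᶠ[𝓝 z] (chartAt (Model n) x).symm := by
      filter_upwards [(chartAt (Model n) x).open_target.mem_nhds hz] with z' hz'
      exact (D.chartAt_symm_eq_cover x hz').2.symm
    have h3 : D.coverDeriv z =
        mfderiv 𝓘(ℝ, Model n) 𝓘(ℝ, Model n) (chartAt (Model n) x).symm z := h2.mfderiv_eq
    rw [pullbackPow, h3, h2.eq_of_nhds]
    rfl
  have h2 : pullbackPow Ω k =ᶠ[𝓝 p] fun z =>
      (pullbackPow Ω k (D.affine l v z)).compContinuousLinearMap (fderiv ℝ (D.affine l v) z) := by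
    filter_upwards [(HalfSpace n).isOpen.mem_nhds hp] with z hz
    rw [(D.hasFDerivAt_affine l v z).fderiv]
    exact pullbackPow_affine Ω k hlv hz
  rw [h2.extDeriv_eq, extDeriv_pullback (r := ∞)
    (differentiableAt_pullbackPow Ω k (hlv p hp).1) (D.contDiff_affine l v).contDiffAt
    (by rw [minSmoothness_of_isRCLikeNormedField]; exact two_le_infty), h1]
  rfl

end PullbackForm

end Datum

end EndoPajitnov

end

/-! ### Conclusion -/

theorem mainTheorem6 (n : ℕ) (hn : 1 < n) (D : EndoPajitnov.Datum n) :
    ¬ ∃ Ω : EndoPajitnov.HermitianMetric (EndoPajitnov.Model n) D.T, Ω.IsBalanced := by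
  open EndoPajitnov EndoPajitnov.Datum in
  rintro ⟨Ω, hΩ⟩
  have hk : Module.finrank ℂ (Model n) - 1 = n := by simp
  rw [HermitianMetric.IsBalanced, hk] at hΩ
  refine D.false_of_closed_invariant_form (φ := pullbackPow Ω n)
    (fun p hp => differentiableAt_pullbackPow Ω n hp) (fun p hp => extDeriv_pullbackPow Ω hΩ hp)
    (fun p hp i => ?_) (fun p hp v => ?_) (fun p hp e => pullbackPow_ne_zero Ω hp e)
  -- Invariance under the generator `g_i`, whose linear part is `A ^ 0`; the next case is the
  -- generator `g_0`.
  · rw [pullbackPow_affine Ω n (D.isDeck_single i) hp, affine, lat_single]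
    rfl
  · rw [pullbackPow_affine Ω n D.isDeck_one hp]
    have : D.affine 1 0 p = D.A p := by simp [affine, lat]
    rw [this]
    rfl
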